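/- Let $n\ge 1$ be an integer, $1<p<\infty$ and $1\le q_1<q_2\le\infty$. Write $B(0,r)=\{x\in\mathbf R^n:|x|<r\}$, $B^*(0,r)=B(0,r)\setminus\{0\}$, and let $\Omega_n=|B(0,1)|$ be the Lebesgue measure of the unit ball of $\mathbf R^n$. For a nonempty open set $\Omega\subset\mathbf R^n$, let $L^{(p,q)}(\Omega)$ be the Lorentz space of measurable functions $f$ on $\Omega$ with $\|f\|_{(p,q)}<\infty$, where $\|f\|_{(p,q)}=\left(\int_0^\infty (t^{1/p}f^{**}(t))^q\,\frac{dt}{t}\right)^{1/q}$ for $q<\infty$, $\|f\|_{(p,\infty)}=\sup_{t>0}t^{1/p}f^{**}(t)$, $f^{**}(t)=\frac1t\int_0^t f^*(s)\,ds$, and $f^*$ is the nonincreasing rearrangement of $f$; for a vector field $F$ put $\|F\|_{(p,q)}=\|\,|F|\,\|_{(p,q)}$. Let $H^{1,(p,q)}(\Omega)$ be the completion of $\{\varphi\in C^\infty(\Omega):\|\varphi\|_{1,(p,q)}<\infty\}$ in the norm $\|\varphi\|_{1,(p,q)}=\left(\|\varphi\|_{(p,q)}^{\rho}+\|\nabla\varphi\|_{(p,q)}^{\rho}\right)^{1/\rho}$,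 $\rho=\min(p,q)$, regarded as a space of functions on $\Omega$ (as a closed subspace of $L^{(p,q)}(\Omega)\times L^{(p,q)}(\Omega;\mathbf R^n)$ via $\varphi\mapsto(\varphi,\nabla\varphi)$), let $H_0^{1,(p,q)}(\Omega)$ be the closure of $C_0^\infty(\Omega)$ in $H^{1,(p,q)}(\Omega)$, and let $W^{1,(p,q)}(\Omega)$ be the space of $u\in L^{(p,q)}(\Omega)$ whose weak partial derivatives $\partial_1u,\dots,\partial_nu$ exist and are in $L^{(p,q)}(\Omega)$. Functions that agree almost everywhere are identified. For $r>0$ and $\alpha\in(0,1]$ define $$u_{rad}(s)=(\Omega_n s^n)^{-1/p}\,\ln^{-\alpha}\!\left(\frac{\Omega_n r^n e^{p\alpha}}{\Omega_n s^n}\right)\quad(0<s<r),\qquad v_{r,\alpha,n,p}(x)=\int_{|x|}^r u_{rad}(s)\,ds\in[0,\infty]\quad(x\in B(0,r)).$$ If $r>0$ and $\alpha\in(0,1]$ satisfy $q_1\le\frac1\alpha<q_2$, then (i) $v_{r,\alpha,n,p}\in H_0^{1,(p,q_2)}(B(0,r))\setminus H^{1,(p,q_1)}(B(0,r))$; (ii)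 $v_{r,\alpha,n,p}\in H^{1,(p,q_2)}(B^*(0,r))\setminus H^{1,(p,q_1)}(B^*(0,r))$. Moreover, $W^{1,(p,q_1)}(\Omega)\subsetneq W^{1,(p,q_2)}(\Omega)$ for every nonempty open set $\Omega\subset\mathbf R^n$. -/

import Mathlib

open MeasureTheory Set Filter Topology
open scoped ENNReal ContDiff

noncomputable section

namespace SobolevLorentz

/-! ### Lorentz spaces -/

section Lorentz

variable {X F : Type*} [MeasurableSpace X] [NormedAddCommGroup F]

/-- The distribution function `λ_f(s) = μ {x : |f x| > s}`. -/
def distribution (μ : Measure X) (f : X → F) (s : ℝ≥0∞) : ℝ≥0∞ :=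
  μ {x | s < ‖f x‖ₑ}

/-- The nonincreasing rearrangement `f^*(t) = inf {s : λ_f(s) ≤ t}`, used for `t > 0`. -/
def rearrangement (μ : Measure X) (f : X → F) (t : ℝ) : ℝ≥0∞ :=
  sInf {s : ℝ≥0∞ | distribution μ f s ≤ ENNReal.ofReal t}

/-- The maximal function `f^{**}(t) = (1/t) ∫₀ᵗ f^*(s) ds`, used for `t > 0`. -/
def maximalRearrangement (μ : Measure X) (f : X → F) (t : ℝ) : ℝ≥0∞ :=
  (∫⁻ s in Ioo (0 : ℝ) t, rearrangement μ f s) / ENNReal.ofReal t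

/-- The Lorentz norm `‖f‖_{(p,q)}`, with values in `[0,∞]`; for a vector-valued `f` it is the norm
of the scalar function `|f|`. -/
def lorentzNorm (μ : Measure X) (p : ℝ) (q : ℝ≥0∞) (f : X → F) : ℝ≥0∞ :=
  if q = ⊤ then
    ⨆ t ∈ Ioi (0 : ℝ), ENNReal.ofReal t ^ (1 / p) * maximalRearrangement μ f t
  else
    (∫⁻ t in Ioi (0 : ℝ),
      (ENNReal.ofReal t ^ (1 / p) * maximalRearrangement μ f t) ^ q.toReal
        / ENNReal.ofReal t) ^ (1 / q.toReal)

/-- Membership in the Lorentz space `L^{(p,q)}`. -/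
def MemLorentz [MeasurableSpace F] (μ : Measure X) (p : ℝ) (q : ℝ≥0∞) (f : X → F) : Prop :=
  AEMeasurable f μ ∧ lorentzNorm μ p q f < ⊤

end Lorentz

/-! ### Sobolev-Lorentz spaces

Functions on an open set `Ω ⊆ ℝⁿ` are represented by functions on `ℝⁿ`, of which only the values
almost everywhere on `Ω` matter. -/

variable {n : ℕ}

/-- The norm `(‖u‖_{(p,q)}^r + ‖V‖_{(p,q)}^r)^{1/r}`, `r = min(p,q)`, of a pair consisting of a
function `u` and a vector field `V` on `Ω`. For `V = ∇ u` it is the Sobolev-Lorentz norm of `u`. -/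
def pairNorm (Ω : Set (EuclideanSpace ℝ (Fin n))) (p : ℝ) (q : ℝ≥0∞)
    (u : EuclideanSpace ℝ (Fin n) → ℝ)
    (V : EuclideanSpace ℝ (Fin n) → EuclideanSpace ℝ (Fin n)) : ℝ≥0∞ :=
  (lorentzNorm (volume.restrict Ω) p q u ^ (min (ENNReal.ofReal p) q).toReal
    + lorentzNorm (volume.restrict Ω) p q V ^ (min (ENNReal.ofReal p) q).toReal)
      ^ (1 / (min (ENNReal.ofReal p) q).toReal)

/-- The test functions `C₀^∞(Ω)`, extended by zero to `ℝⁿ`. -/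
def testFunctions (Ω : Set (EuclideanSpace ℝ (Fin n))) :
    Set (EuclideanSpace ℝ (Fin n) → ℝ) :=
  {φ | ContDiff ℝ ∞ φ ∧ HasCompactSupport φ ∧ tsupport φ ⊆ Ω}

/-- The functions `φ ∈ C^∞(Ω)` of finite Sobolev-Lorentz norm. -/
def smoothFunctions (Ω : Set (EuclideanSpace ℝ (Fin n))) (p : ℝ) (q : ℝ≥0∞) :
    Set (EuclideanSpace ℝ (Fin n) → ℝ) :=
  {φ | ContDiffOn ℝ ∞ φ Ω ∧ pairNorm Ω p q φ (gradient φ) < ⊤}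

/-- The closure of a set `S` of functions that are smooth on `Ω`, in the Sobolev-Lorentz norm. The
map `φ ↦ (φ, ∇ φ)` is an isometry into the complete space `L^{(p,q)}(Ω) × L^{(p,q)}(Ω; ℝⁿ)`, so
that the completion of `S` is the closure of its image there, and `u` belongs to it if
`u` is the first component of a pair in this closure. -/
def sobolevClosure (Ω : Set (EuclideanSpace ℝ (Fin n))) (p : ℝ) (q : ℝ≥0∞)
    (S : Set (EuclideanSpace ℝ (Fin n) → ℝ)) : Set (EuclideanSpace ℝ (Fin n) → ℝ) :=
  {u | MemLorentz (volume.restrict Ω) p q u ∧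
    ∃ V : EuclideanSpace ℝ (Fin n) → EuclideanSpace ℝ (Fin n),
      MemLorentz (volume.restrict Ω) p q V ∧
      ∃ φ : ℕ → EuclideanSpace ℝ (Fin n) → ℝ, (∀ k, φ k ∈ S) ∧
        Tendsto (fun k => pairNorm Ω p q (u - φ k) (V - gradient (φ k))) atTop (𝓝 0)}

/-- The space `H^{1,(p,q)}(Ω)`: the completion of the smooth functions on `Ω` of finite norm. -/
def H (Ω : Set (EuclideanSpace ℝ (Fin n))) (p : ℝ) (q : ℝ≥0∞) :
    Set (EuclideanSpace ℝ (Fin n) → ℝ) :=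
  sobolevClosure Ω p q (smoothFunctions Ω p q)

/-- The space `H₀^{1,(p,q)}(Ω)`: the closure of `C₀^∞(Ω)` in `H^{1,(p,q)}(Ω)`. -/
def H₀ (Ω : Set (EuclideanSpace ℝ (Fin n))) (p : ℝ) (q : ℝ≥0∞) :
    Set (EuclideanSpace ℝ (Fin n) → ℝ) :=
  H Ω p q ∩ sobolevClosure Ω p q (testFunctions Ω)

/-- `w` is the `i`-th weak partial derivative of `u` on `Ω`. -/
def IsWeakPartial (Ω : Set (EuclideanSpace ℝ (Fin n))) (i : Fin n)
    (u w : EuclideanSpace ℝ (Fin n) → ℝ) : Prop :=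
  LocallyIntegrableOn u Ω ∧ LocallyIntegrableOn w Ω ∧
    ∀ φ ∈ testFunctions Ω,
      ∫ x in Ω, φ x * w x = - ∫ x in Ω, fderiv ℝ φ x (EuclideanSpace.single i 1) * u x

/-- The space `W^{1,(p,q)}(Ω)`: functions in `L^{(p,q)}(Ω)` whose weak partial derivatives
exist and are in `L^{(p,q)}(Ω)`. -/
def W (Ω : Set (EuclideanSpace ℝ (Fin n))) (p : ℝ) (q : ℝ≥0∞) :
    Set (EuclideanSpace ℝ (Fin n) → ℝ) :=
  {u | MemLorentz (volume.restrict Ω) p q u ∧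
    ∀ i : Fin n, ∃ w : EuclideanSpace ℝ (Fin n) → ℝ,
      IsWeakPartial Ω i u w ∧ MemLorentz (volume.restrict Ω) p q w}

/-! ### The radial function -/

/-- The measure `Ω_n` of the unit ball of `ℝⁿ`. -/
def unitBallVolume (n : ℕ) : ℝ :=
  (volume (Metric.ball (0 : EuclideanSpace ℝ (Fin n)) 1)).toReal

/-- `u(t) = t^{-1/p} ln^{-α}(Ω_n r^n e^{pα} / t)`, used for `0 < t < Ω_n r^n`. -/
def uProfile (r α : ℝ) (n : ℕ) (p t : ℝ) : ℝ :=
  t ^ (-(1 / p)) * Real.log (unitBallVolume n * r ^ n * Real.exp (p * α) / t) ^ (-α)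

/-- `u_rad(s) = u(Ω_n s^n)`, used for `0 < s < r`. -/
def uRad (r α : ℝ) (n : ℕ) (p s : ℝ) : ℝ :=
  uProfile r α n p (unitBallVolume n * s ^ n)

/-- `v(x) = ∫_{|x|}^r u_rad(s) ds`, with values in `[0,∞]`; the value `∞` is possible at `x = 0`
only. -/
def v (r α : ℝ) (n : ℕ) (p : ℝ) (x : EuclideanSpace ℝ (Fin n)) : ℝ≥0∞ :=
  ∫⁻ s in Ioo ‖x‖ r, ENNReal.ofReal (uRad r α n p s)

/-- The real-valued representative of `v`; it differs from `v` at most at the origin. -/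
def vReal (r α : ℝ) (n : ℕ) (p : ℝ) (x : EuclideanSpace ℝ (Fin n)) : ℝ :=
  (v r α n p x).toReal

end SobolevLorentz

end

/-! Everything rests on one radial computation. The modulus of ∇v is the decreasing function `uRad`
of |x|, so for 0 < t < Ω_n r^n its rearrangement is, up to null sets, the profile u(t) = t^(-1/p)
L(t)^(-α) with L(t) = ln(Ω_n r^n e^(pα) / t). The shift by pα in L is what keeps u decreasing up to
the boundary of the ball. Since p > 1, averaging over (0, t) costs only a factor 1/(1 - 1/p), and
t^(1/p) f**(t) is comparable to L(t)^(-α). The substitution y = L(t), under which dt/t becomes dy up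
to orientation, turns the Lorentz integral near 0 into ∫ y^(-αq) dy over (pα, ∞). Hence |∇v| is in
L^(p,q) exactly when q > 1/α (`lorentzNorm_gradModulus_lt_top`, `lorentzNorm_gradModulus_eq_top`).
The function v itself costs nothing, since v ≤ r |∇v|.

For membership, the profile is cut off near 0 and near r and integrated. This gives test functions
of the ball that are constant near the origin, and they converge to v by dominated convergence
(`tendsto_lorentzNorm_of_dominated`). That argument needs a finite exponent. It is therefore run
with a finite q' between 1/α and q₂, and the embedding of L^(p,q') in L^(p,q₂)
(`lorentzNorm_le_of_le`) covers q₂ = ∞ as well.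

For non-membership, H ⊆ W (`H_subset_W`) and weak derivatives are unique (`IsWeakPartial.ae_eq`). A
function in W with exponent q₁ ≤ 1/α that equals v on the punctured ball would force ∇v into
L^(p,q₁), which has been excluded (`vReal_notMem_W`). Strictness of the inclusion of the W spaces on
any Ω follows by translating v into a ball inside Ω and taking α = 1/q₁. -/

noncomputable section

namespace SobolevLorentz

/-! ### Rearrangements and Lorentz norms: embeddings, local integrability, dominated convergence -/

section LorentzLemmas

variable {X F : Type*} [MeasurableSpace X] [NormedAddCommGroup F]
variable {Y G : Type*} [MeasurableSpace Y] [NormedAddCommGroup G]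

theorem distribution_antitone (μ : Measure X) (f : X → F) : Antitone (distribution μ f) :=
  fun _ _ h => measure_mono fun _ hx => lt_of_le_of_lt h hx

theorem distribution_mono_measure {μ ν : Measure X} (h : μ ≤ ν) (f : X → F) (s : ℝ≥0∞) :
    distribution μ f s ≤ distribution ν f s :=
  h _

theorem distribution_mono_ae {μ : Measure X} {f : X → F} {g : X → G}
    (h : ∀ᵐ x ∂μ, ‖f x‖ₑ ≤ ‖g x‖ₑ) (s : ℝ≥0∞) : distribution μ f s ≤ distribution μ g s := by
  refine measure_mono_ae ?_
  filter_upwards [h] with x hx hs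
  exact lt_of_lt_of_le (show s < ‖f x‖ₑ from hs) hx

theorem rearrangement_antitone (μ : Measure X) (f : X → F) : Antitone (rearrangement μ f) :=
  fun _ _ h => sInf_le_sInf fun _ hs => le_trans hs (ENNReal.ofReal_le_ofReal h)

theorem measurable_rearrangement (μ : Measure X) (f : X → F) : Measurable (rearrangement μ f) :=
  (rearrangement_antitone μ f).measurable

theorem rearrangement_le {μ : Measure X} {f : X → F} {s : ℝ≥0∞} {t : ℝ}
    (h : distribution μ f s ≤ ENNReal.ofReal t) : rearrangement μ f t ≤ s :=
  sInf_le h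

theorem le_rearrangement {μ : Measure X} {f : X → F} {s : ℝ≥0∞} {t : ℝ}
    (h : ENNReal.ofReal t < distribution μ f s) : s ≤ rearrangement μ f t := by
  refine le_sInf fun s' hs' => ?_
  by_contra hlt
  exact absurd (lt_of_lt_of_le h (distribution_antitone μ f (not_le.1 hlt).le)) (not_lt.2 hs')

theorem rearrangement_mono {μ : Measure X} {ν : Measure Y} {f : X → F} {g : Y → G}
    (h : ∀ s, distribution μ f s ≤ distribution ν g s) (t : ℝ) :
    rearrangement μ f t ≤ rearrangement ν g t :=
  sInf_le_sInf fun s hs => (h s).trans hs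

theorem measurable_maximalRearrangement (μ : Measure X) (f : X → F) :
    Measurable (maximalRearrangement μ f) := by
  refine Measurable.div ?_ ENNReal.measurable_ofReal
  exact Monotone.measurable fun a b h => lintegral_mono_set (Ioo_subset_Ioo_right h)

/-- The Lorentz norm is a monotone function of `f^{**}`. -/
theorem lorentzNorm_le_const_mul {μ : Measure X} {ν : Measure Y} {f : X → F} {g : Y → G}
    {p : ℝ} {q : ℝ≥0∞} (hq1 : 1 ≤ q) {c : ℝ≥0∞} (hc : c ≠ ⊤)
    (h : ∀ t, 0 < t → maximalRearrangement μ f t ≤ c * maximalRearrangement ν g t) :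
    lorentzNorm μ p q f ≤ c * lorentzNorm ν p q g := by
  unfold lorentzNorm
  split_ifs with hq
  · refine iSup₂_le fun t ht => ?_
    calc _ ≤ ENNReal.ofReal t ^ (1 / p) * (c * maximalRearrangement ν g t) := by
          gcongr; exact h t ht
      _ = c * (ENNReal.ofReal t ^ (1 / p) * maximalRearrangement ν g t) := by ring
      _ ≤ _ := by
          gcongr
          exact le_iSup₂ (f := fun t (_ : t ∈ Ioi (0 : ℝ)) =>
            ENNReal.ofReal t ^ (1 / p) * maximalRearrangement ν g t) t ht
  · have hQ : 0 < q.toReal := ENNReal.toReal_pos (zero_lt_one.trans_le hq1).ne' hq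
    have hcQ : c ^ q.toReal ≠ ⊤ := ENNReal.rpow_ne_top_of_nonneg hQ.le hc
    have hI : (∫⁻ t in Ioi (0 : ℝ),
          (ENNReal.ofReal t ^ (1 / p) * maximalRearrangement μ f t) ^ q.toReal / ENNReal.ofReal t)
        ≤ c ^ q.toReal * ∫⁻ t in Ioi (0 : ℝ),
          (ENNReal.ofReal t ^ (1 / p) * maximalRearrangement ν g t) ^ q.toReal
            / ENNReal.ofReal t := by
      rw [← lintegral_const_mul' _ _ hcQ]
      refine setLIntegral_mono' measurableSet_Ioi fun t ht => ?_
      rw [← mul_div_assoc, ← ENNReal.mul_rpow_of_nonneg _ _ hQ.le]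
      refine ENNReal.div_le_div_right (ENNReal.rpow_le_rpow ?_ hQ.le) _
      calc _ ≤ ENNReal.ofReal t ^ (1 / p) * (c * maximalRearrangement ν g t) := by
            gcongr; exact h t ht
        _ = c * (ENNReal.ofReal t ^ (1 / p) * maximalRearrangement ν g t) := by ring
    refine (ENNReal.rpow_le_rpow hI (by positivity)).trans ?_
    rw [ENNReal.mul_rpow_of_nonneg _ _ (by positivity), ← ENNReal.rpow_mul,
      mul_one_div_cancel hQ.ne', ENNReal.rpow_one]

theorem maximalRearrangement_mono {μ : Measure X} {ν : Measure Y} {f : X → F} {g : Y → G}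
    (h : ∀ s, distribution μ f s ≤ distribution ν g s) (t : ℝ) :
    maximalRearrangement μ f t ≤ maximalRearrangement ν g t :=
  ENNReal.div_le_div_right (lintegral_mono fun s => rearrangement_mono h s) _

theorem lorentzNorm_mono {μ : Measure X} {ν : Measure Y} {f : X → F} {g : Y → G}
    {p : ℝ} {q : ℝ≥0∞} (hq1 : 1 ≤ q)
    (h : ∀ s, distribution μ f s ≤ distribution ν g s) :
    lorentzNorm μ p q f ≤ lorentzNorm ν p q g := by
  simpa using lorentzNorm_le_const_mul (p := p) hq1 (c := 1) ENNReal.one_ne_top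
    fun t _ => by simpa using maximalRearrangement_mono h t

/-- The weak quantity at t is recovered from the integral over [t, 2t] alone, because s f**(s) and
s^(1/p) are both nondecreasing. The constant does not depend on q. -/
theorem rpow_mul_maximalRearrangement_le {μ : Measure X} {f : X → F} {p : ℝ} (hp : 0 < p)
    {q : ℝ≥0∞} (hq1 : 1 ≤ q) {t : ℝ} (ht : 0 < t) :
    ENNReal.ofReal t ^ (1 / p) * maximalRearrangement μ f t ≤ 4 * lorentzNorm μ p q f := by
  unfold lorentzNorm
  split_ifs with hq
  · refine le_trans (le_iSup₂ (f := fun t (_ : t ∈ Ioi (0 : ℝ)) =>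
            ENNReal.ofReal t ^ (1 / p) * maximalRearrangement μ f t) t ht) ?_
    exact le_mul_of_one_le_left zero_le (by norm_num)
  · have hQ1 : 1 ≤ q.toReal := by
      simpa using (ENNReal.toReal_le_toReal ENNReal.one_ne_top hq).2 hq1
    have hQ : 0 < q.toReal := by linarith
    set A := ENNReal.ofReal t ^ (1 / p) * maximalRearrangement μ f t with hA
    have h2t : ENNReal.ofReal (2 * t) = 2 * ENNReal.ofReal t := by
      rw [ENNReal.ofReal_mul (by norm_num)]; norm_num
    have ht0 : ENNReal.ofReal t ≠ 0 := by simpa using ht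
    have key : ∀ s ∈ Icc t (2 * t), (A / 2) ^ q.toReal / ENNReal.ofReal (2 * t) ≤
        (ENNReal.ofReal s ^ (1 / p) * maximalRearrangement μ f s) ^ q.toReal
          / ENNReal.ofReal s := by
      intro s hs
      refine ENNReal.div_le_div (ENNReal.rpow_le_rpow ?_ hQ.le) (ENNReal.ofReal_le_ofReal hs.2)
      rw [hA, mul_div_assoc]
      refine mul_le_mul' (ENNReal.rpow_le_rpow (ENNReal.ofReal_le_ofReal hs.1) (by positivity)) ?_
      unfold maximalRearrangement
      calc _ = (∫⁻ s in Ioo (0 : ℝ) t, rearrangement μ f s) / ENNReal.ofReal (2 * t) := by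
            rw [h2t, div_eq_mul_inv, div_eq_mul_inv, div_eq_mul_inv, mul_assoc,
              ENNReal.mul_inv (by simp) (by simp), mul_comm (2 : ℝ≥0∞)⁻¹]
        _ ≤ _ := ENNReal.div_le_div (lintegral_mono_set (Ioo_subset_Ioo_right hs.1))
            (ENNReal.ofReal_le_ofReal hs.2)
    have hI : (A / 2) ^ q.toReal / 2 ≤ ∫⁻ t in Ioi (0 : ℝ),
        (ENNReal.ofReal t ^ (1 / p) * maximalRearrangement μ f t) ^ q.toReal
          / ENNReal.ofReal t := by
      calc (A / 2) ^ q.toReal / 2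
          = ∫⁻ _ in Icc t (2 * t), (A / 2) ^ q.toReal / ENNReal.ofReal (2 * t) := by
            rw [setLIntegral_const, Real.volume_Icc, h2t, show 2 * t - t = t by ring,
              div_eq_mul_inv _ (2 : ℝ≥0∞), div_eq_mul_inv _ (2 * _),
              ENNReal.mul_inv (by simp) (by simp), mul_assoc, mul_assoc,
              ENNReal.inv_mul_cancel ht0 (by simp), mul_one]
        _ ≤ ∫⁻ s in Icc t (2 * t), (ENNReal.ofReal s ^ (1 / p) * maximalRearrangement μ f s) ^
              q.toReal / ENNReal.ofReal s := setLIntegral_mono' measurableSet_Icc key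
        _ ≤ _ := lintegral_mono_set fun s hs => lt_of_lt_of_le ht hs.1
    -- Here q ≥ 1 enters, through 2 ≤ 2^q. One factor 2 comes from f**(s) ≥ f**(t)/2 and one from
    -- this step, which together make the 4.
    have h3 : (A / 2 / 2) ^ q.toReal ≤ (A / 2) ^ q.toReal / 2 := by
      rw [ENNReal.div_rpow_of_nonneg _ _ hQ.le]
      gcongr
      simpa using ENNReal.rpow_le_rpow_of_exponent_le (x := 2) (by norm_num) hQ1
    have h4 := ENNReal.rpow_le_rpow (h3.trans hI) (z := 1 / q.toReal) (by positivity)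
    rw [← ENNReal.rpow_mul, mul_one_div_cancel hQ.ne', ENNReal.rpow_one] at h4
    calc A = 4 * (A / 2 / 2) := by
          rw [div_eq_mul_inv, div_eq_mul_inv, mul_assoc, ← ENNReal.mul_inv (by simp) (by simp),
            show (2 : ℝ≥0∞) * 2 = 4 by norm_num, mul_comm A, ← mul_assoc,
            ENNReal.mul_inv_cancel (by simp) (by simp), one_mul]
      _ ≤ _ := by gcongr

/-- Write the power q₂ as (q₂ - q₁) + q₁ and bound the first factor by the supremum, which the
q₁-norm already controls. -/
theorem lorentzNorm_le_of_le {μ : Measure X} {f : X → F} {p : ℝ} (hp : 0 < p)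
    {q₁ q₂ : ℝ≥0∞} (hq₁ : 1 ≤ q₁) (hq : q₁ ≤ q₂) :
    lorentzNorm μ p q₂ f ≤ 4 * lorentzNorm μ p q₁ f := by
  have hw := fun t (ht : 0 < t) => rpow_mul_maximalRearrangement_le (μ := μ) (f := f) hp hq₁ ht
  rcases eq_or_ne q₂ ⊤ with rfl | hq2
  · conv_lhs => unfold lorentzNorm
    rw [if_pos rfl]
    exact iSup₂_le fun t ht => hw t ht
  have hq1 : q₁ ≠ ⊤ := ne_top_of_le_ne_top hq2 hq
  have hQ1 : 0 < q₁.toReal := ENNReal.toReal_pos (zero_lt_one.trans_le hq₁).ne' hq1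
  have hQ : q₁.toReal ≤ q₂.toReal := (ENNReal.toReal_le_toReal hq1 hq2).2 hq
  set N := lorentzNorm μ p q₁ f with hN
  rcases eq_or_ne N ⊤ with hNt | hNt
  · rw [hNt]; simp
  have hNI : (∫⁻ t in Ioi (0 : ℝ), (ENNReal.ofReal t ^ (1 / p) * maximalRearrangement μ f t) ^
      q₁.toReal / ENNReal.ofReal t) = N ^ q₁.toReal := by
    rw [hN, lorentzNorm, if_neg hq1, ← ENNReal.rpow_mul, one_div_mul_cancel hQ1.ne',
      ENNReal.rpow_one]
  have hI : (∫⁻ t in Ioi (0 : ℝ), (ENNReal.ofReal t ^ (1 / p) * maximalRearrangement μ f t) ^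
      q₂.toReal / ENNReal.ofReal t) ≤ (4 * N) ^ q₂.toReal := by
    calc _ ≤ ∫⁻ t in Ioi (0 : ℝ), (4 * N) ^ (q₂.toReal - q₁.toReal) *
          ((ENNReal.ofReal t ^ (1 / p) * maximalRearrangement μ f t) ^
            q₁.toReal / ENNReal.ofReal t) := by
          refine setLIntegral_mono' measurableSet_Ioi fun t ht => ?_
          rw [← mul_div_assoc]
          gcongr
          calc _ = (ENNReal.ofReal t ^ (1 / p) * maximalRearrangement μ f t) ^
                    ((q₂.toReal - q₁.toReal) + q₁.toReal) := by ring_nf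
            _ = _ := ENNReal.rpow_add_of_nonneg _ _ (by linarith) hQ1.le
            _ ≤ _ := by
                exact mul_le_mul_left (ENNReal.rpow_le_rpow (hw t ht) (by linarith)) _
      _ = (4 * N) ^ (q₂.toReal - q₁.toReal) * N ^ q₁.toReal := by
          rw [lintegral_const_mul', hNI]
          exact ENNReal.rpow_ne_top_of_nonneg (by linarith) (ENNReal.mul_ne_top (by simp) hNt)
      _ ≤ (4 * N) ^ (q₂.toReal - q₁.toReal) * (4 * N) ^ q₁.toReal := by
          gcongr
          exact le_mul_of_one_le_left zero_le (by norm_num)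
      _ = _ := by
          rw [← ENNReal.rpow_add_of_nonneg _ _ (by linarith) hQ1.le]; ring_nf
  rw [lorentzNorm, if_neg hq2]
  refine (ENNReal.rpow_le_rpow hI (by positivity)).trans ?_
  rw [← ENNReal.rpow_mul, mul_one_div_cancel (by linarith), ENNReal.rpow_one]

theorem rearrangement_le_const_mul {μ : Measure X} {f : X → F} {g : X → G} {c : ℝ≥0∞}
    (hc0 : c ≠ 0) (hc : c ≠ ⊤) (h : ∀ᵐ x ∂μ, ‖f x‖ₑ ≤ c * ‖g x‖ₑ) (t : ℝ) :
    rearrangement μ f t ≤ c * rearrangement μ g t := by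
  rw [mul_comm, ← ENNReal.div_le_iff hc0 hc]
  refine le_sInf fun s hs => ?_
  rw [ENNReal.div_le_iff hc0 hc]
  refine rearrangement_le (le_trans (measure_mono_ae ?_) hs)
  filter_upwards [h] with x hx (hs : _ < _)
  have h1 : s * c < c * ‖g x‖ₑ := lt_of_lt_of_le hs hx
  rw [mul_comm c] at h1
  exact (ENNReal.mul_lt_mul_iff_left hc0 hc).1 h1

theorem lorentzNorm_le_const_mul_of_enorm_le {μ : Measure X} {f : X → F} {g : X → G} {p : ℝ}
    {q : ℝ≥0∞} (hq1 : 1 ≤ q) {c : ℝ≥0∞} (hc0 : c ≠ 0) (hc : c ≠ ⊤)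
    (h : ∀ᵐ x ∂μ, ‖f x‖ₑ ≤ c * ‖g x‖ₑ) :
    lorentzNorm μ p q f ≤ c * lorentzNorm μ p q g := by
  refine lorentzNorm_le_const_mul hq1 hc fun t _ => ?_
  unfold maximalRearrangement
  rw [← mul_div_assoc, ← lintegral_const_mul' _ _ hc]
  gcongr
  exact rearrangement_le_const_mul hc0 hc h _

/-- The integral of the rearrangement dominates the integral of the function. -/
theorem lintegral_enorm_le_lintegral_rearrangement {μ : Measure X} {f : X → F}
    (hf : AEMeasurable (fun x => ‖f x‖) μ) :
    ∫⁻ x, ‖f x‖ₑ ∂μ ≤ ∫⁻ t in Ioi (0 : ℝ), rearrangement μ f t := by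
  have hd : Measurable fun s : ℝ => distribution μ f (ENNReal.ofReal s) :=
    Antitone.measurable fun a b h => distribution_antitone μ f (ENNReal.ofReal_le_ofReal h)
  -- Layer cake followed by Tonelli on the region under the graph of the distribution function: its
  -- sections in t have length λ_f(s), and its sections in s lie in [0, f*(t)].
  let S : Set (ℝ × ℝ) := {z | ENNReal.ofReal z.2 < distribution μ f (ENNReal.ofReal z.1)}
  have hS : MeasurableSet S :=
    measurableSet_lt (ENNReal.measurable_ofReal.comp measurable_snd) (hd.comp measurable_fst)
  have hvol : ∀ a : ℝ≥0∞, volume ({t : ℝ | ENNReal.ofReal t < a} ∩ Ioi 0) = a := by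
    intro a
    rcases eq_or_ne a ⊤ with rfl | ha
    · simp
    · have : {t : ℝ | ENNReal.ofReal t < a} ∩ Ioi 0 = Ioo 0 a.toReal := by
        ext t
        simp only [mem_inter_iff, mem_ofPred_eq, mem_Ioi, mem_Ioo]
        constructor
        · rintro ⟨h1, h2⟩
          exact ⟨h2, (ENNReal.ofReal_lt_iff_lt_toReal h2.le ha).1 h1⟩
        · rintro ⟨h1, h2⟩
          exact ⟨(ENNReal.ofReal_lt_iff_lt_toReal h1.le ha).2 h2, h1⟩
      rw [this, Real.volume_Ioo, sub_zero, ENNReal.ofReal_toReal ha]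
  calc ∫⁻ x, ‖f x‖ₑ ∂μ = ∫⁻ x, ENNReal.ofReal ‖f x‖ ∂μ := by simp
    _ = ∫⁻ s in Ioi (0 : ℝ), μ {x | s < ‖f x‖} :=
        lintegral_eq_lintegral_meas_lt μ (Eventually.of_forall fun _ => norm_nonneg _) hf
    _ = ∫⁻ s in Ioi (0 : ℝ), distribution μ f (ENNReal.ofReal s) := by
        refine setLIntegral_congr_fun measurableSet_Ioi fun s hs => ?_
        simp only [distribution]
        congr 1
        ext x
        rw [mem_ofPred_eq, mem_ofPred_eq, ← ofReal_norm,
          ENNReal.ofReal_lt_ofReal_iff_of_nonneg (le_of_lt hs)]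
    _ = ∫⁻ s in Ioi (0 : ℝ), ∫⁻ t in Ioi (0 : ℝ), S.indicator 1 (s, t) := by
        refine lintegral_congr fun s => ?_
        rw [← hvol (distribution μ f (ENNReal.ofReal s))]
        have hm : MeasurableSet {t : ℝ | ENNReal.ofReal t <
            distribution μ f (ENNReal.ofReal s)} :=
          measurableSet_lt ENNReal.measurable_ofReal measurable_const
        rw [← Measure.restrict_apply hm, ← lintegral_indicator_one hm]
        rfl
    _ = ∫⁻ t in Ioi (0 : ℝ), ∫⁻ s in Ioi (0 : ℝ), S.indicator 1 (s, t) :=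
        lintegral_lintegral_swap ((measurable_one.indicator hS).aemeasurable)
    _ ≤ ∫⁻ t in Ioi (0 : ℝ), rearrangement μ f t := by
        refine lintegral_mono fun t => ?_
        rw [← hvol (rearrangement μ f t)]
        have hm : MeasurableSet {s : ℝ | ENNReal.ofReal t <
            distribution μ f (ENNReal.ofReal s)} := measurableSet_lt measurable_const hd
        have : (fun s => S.indicator (1 : ℝ × ℝ → ℝ≥0∞) (s, t)) = {s : ℝ | ENNReal.ofReal t <
            distribution μ f (ENNReal.ofReal s)}.indicator 1 := rfl
        rw [this, lintegral_indicator_one hm, Measure.restrict_apply hm]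
        have hle : {s : ℝ | ENNReal.ofReal t < distribution μ f (ENNReal.ofReal s)} ∩ Ioi 0 ⊆
            {s : ℝ | ENNReal.ofReal s ≤ rearrangement μ f t} ∩ Ioi 0 := fun s hs =>
          ⟨le_rearrangement hs.1, hs.2⟩
        -- The section is only known to satisfy s ≤ f*(t), while `hvol` measures s < f*(t). The two
        -- sets differ by at most one point.
        refine (measure_mono hle).trans (le_of_eq (measure_congr ?_))
        rcases eq_or_ne (rearrangement μ f t) ⊤ with h | h
        · simp only [h, le_top, ENNReal.ofReal_lt_top]
          exact EventuallyEq.rfl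
        · have : ∀ᵐ s : ℝ, s ≠ (rearrangement μ f t).toReal := by
            simp [ae_iff]
          filter_upwards [this] with s hs
          refine propext (and_congr_left fun h0 => ?_)
          constructor
          · intro h1
            have h1' : ENNReal.ofReal s ≤ rearrangement μ f t := h1
            refine lt_of_le_of_ne h1' fun he => hs ?_
            rw [← he, ENNReal.toReal_ofReal (le_of_lt h0)]
          · intro h1
            have h1' : ENNReal.ofReal s < rearrangement μ f t := h1
            exact h1'.le

/-- On a set of finite measure the Lorentz norm controls the integral. -/
theorem exists_lintegral_enorm_le_mul_lorentzNorm (μ : Measure X) [IsFiniteMeasure μ] {p : ℝ}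
    (hp : 0 < p) {q : ℝ≥0∞} (hq1 : 1 ≤ q) :
    ∃ C : ℝ≥0∞, C ≠ ⊤ ∧ ∀ f : X → F, AEMeasurable (fun x => ‖f x‖) μ →
      ∫⁻ x, ‖f x‖ₑ ∂μ ≤ C * lorentzNorm μ p q f := by
  -- Beyond the total mass the rearrangement vanishes, so its whole integral equals T f**(T). Adding
  -- 1 keeps T positive when μ = 0.
  set T : ℝ := (μ univ).toReal + 1 with hT
  have hT0 : 0 < T := by positivity
  have hTe : ENNReal.ofReal T ≠ 0 := by simpa using hT0
  have hTr : ENNReal.ofReal T ^ (1 / p) ≠ 0 := by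
    simp [ENNReal.rpow_eq_zero_iff, hT0]
  have hTr' : ENNReal.ofReal T ^ (1 / p) ≠ ⊤ :=
    ENNReal.rpow_ne_top_of_nonneg (by positivity) (by simp)
  refine ⟨ENNReal.ofReal T * (ENNReal.ofReal T ^ (1 / p))⁻¹ * 4,
    ENNReal.mul_ne_top (ENNReal.mul_ne_top (by simp) (by simpa using hTr)) (by simp),
    fun f hf => ?_⟩
  have h0 : ∀ t, T ≤ t → rearrangement μ f t = 0 := by
    intro t ht
    refine le_antisymm (rearrangement_le ?_) zero_le
    refine (measure_mono (subset_univ _)).trans ?_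
    rw [← ENNReal.ofReal_toReal (measure_ne_top μ univ)]
    exact ENNReal.ofReal_le_ofReal (by linarith)
  calc ∫⁻ x, ‖f x‖ₑ ∂μ ≤ ∫⁻ t in Ioi (0 : ℝ), rearrangement μ f t :=
        lintegral_enorm_le_lintegral_rearrangement hf
    _ = ∫⁻ t in Ioo (0 : ℝ) T, rearrangement μ f t := by
        rw [← lintegral_indicator measurableSet_Ioi, ← lintegral_indicator measurableSet_Ioo]
        refine lintegral_congr fun t => ?_
        by_cases h1 : (0 : ℝ) < t
        · by_cases h2 : t < T
          · rw [indicator_of_mem (show t ∈ Ioi (0 : ℝ) from h1),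
              indicator_of_mem (show t ∈ Ioo (0 : ℝ) T from ⟨h1, h2⟩)]
          · rw [indicator_of_mem (show t ∈ Ioi (0 : ℝ) from h1),
              indicator_of_notMem (fun h => h2 h.2), h0 t (not_lt.1 h2)]
        · rw [indicator_of_notMem (s := Ioi (0 : ℝ)) (fun h => h1 h),
            indicator_of_notMem (fun h => h1 h.1)]
    _ = ENNReal.ofReal T * maximalRearrangement μ f T := by
        rw [maximalRearrangement, ENNReal.mul_div_cancel hTe (by simp)]
    _ = ENNReal.ofReal T * (ENNReal.ofReal T ^ (1 / p))⁻¹ *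
          (ENNReal.ofReal T ^ (1 / p) * maximalRearrangement μ f T) := by
        rw [mul_assoc, ← mul_assoc (_⁻¹), ENNReal.inv_mul_cancel hTr hTr', one_mul]
    _ ≤ ENNReal.ofReal T * (ENNReal.ofReal T ^ (1 / p))⁻¹ * (4 * lorentzNorm μ p q f) := by
        exact mul_le_mul_right (rpow_mul_maximalRearrangement_le hp hq1 hT0) _
    _ = _ := by ring

theorem maximalRearrangement_lt_top {μ : Measure X} {f : X → F} {p : ℝ} (hp : 0 < p)
    {q : ℝ≥0∞} (hq1 : 1 ≤ q) (hf : lorentzNorm μ p q f < ⊤) {t : ℝ} (ht : 0 < t) :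
    maximalRearrangement μ f t < ⊤ := by
  have h := rpow_mul_maximalRearrangement_le (μ := μ) (f := f) hp hq1 ht
  refine lt_top_iff_ne_top.2 fun he => ?_
  rw [he, ENNReal.mul_top (by simp [ENNReal.rpow_eq_zero_iff, ht])] at h
  exact absurd h (not_le.2 (ENNReal.mul_lt_top (by simp) hf))

/-- Dominated convergence in Lorentz spaces. -/
theorem tendsto_lorentzNorm_of_dominated {μ : Measure X} {f : ℕ → X → F} {g : X → G} {p : ℝ}
    (hp : 0 < p) {q : ℝ≥0∞} (hq1 : 1 ≤ q) (hq : q ≠ ⊤) (hg : lorentzNorm μ p q g < ⊤)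
    (hdom : ∀ k s, distribution μ (f k) s ≤ distribution μ g s)
    (hlim : ∀ ε : ℝ≥0∞, ε ≠ 0 → Tendsto (fun k => distribution μ (f k) ε) atTop (𝓝 0)) :
    Tendsto (fun k => lorentzNorm μ p q (f k)) atTop (𝓝 0) := by
  have hQ : 0 < q.toReal := ENNReal.toReal_pos (zero_lt_one.trans_le hq1).ne' hq
  -- Convergence in measure gives f_k* → 0 pointwise. Domination by g* and then by g** carries this
  -- through the average and through the Lorentz integral. The last passage is an integral limit
  -- only because q < ∞.
  have hr : ∀ t : ℝ, 0 < t → Tendsto (fun k => rearrangement μ (f k) t) atTop (𝓝 0) := by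
    intro t ht
    refine ENNReal.tendsto_nhds_zero.2 fun ε hε => ?_
    filter_upwards [ENNReal.tendsto_nhds_zero.1 (hlim ε hε.ne') (ENNReal.ofReal t)
      (by simpa using ht)] with k hk
    exact rearrangement_le hk
  have hm : ∀ t : ℝ, 0 < t → Tendsto (fun k => maximalRearrangement μ (f k) t) atTop (𝓝 0) := by
    intro t ht
    have h1 : Tendsto (fun k => ∫⁻ s in Ioo (0 : ℝ) t, rearrangement μ (f k) s) atTop
        (𝓝 (∫⁻ s in Ioo (0 : ℝ) t, 0)) := by
      refine tendsto_lintegral_of_dominated_convergence (rearrangement μ g)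
        (fun k => measurable_rearrangement _ _)
        (fun k => Eventually.of_forall fun s => rearrangement_mono (hdom k) s) ?_ ?_
      · intro he
        have := maximalRearrangement_lt_top hp hq1 hg ht
        rw [maximalRearrangement, he, ENNReal.top_div_of_ne_top (by simp)] at this
        exact lt_irrefl _ this
      · filter_upwards [ae_restrict_mem measurableSet_Ioo] with s hs
        exact hr s hs.1
    have h2 := ENNReal.Tendsto.div_const (b := ENNReal.ofReal t) h1
      (Or.inr (by simpa using ht))
    simpa [maximalRearrangement] using h2
  have hI : Tendsto (fun k => ∫⁻ t in Ioi (0 : ℝ),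
      (ENNReal.ofReal t ^ (1 / p) * maximalRearrangement μ (f k) t) ^ q.toReal
        / ENNReal.ofReal t) atTop (𝓝 (∫⁻ t in Ioi (0 : ℝ), 0)) := by
    refine tendsto_lintegral_of_dominated_convergence
      (fun t => (ENNReal.ofReal t ^ (1 / p) * maximalRearrangement μ g t) ^ q.toReal
        / ENNReal.ofReal t) (fun k => ?_) (fun k => Eventually.of_forall fun t => ?_) ?_ ?_
    · exact (((ENNReal.measurable_ofReal.pow_const _).mul
        (measurable_maximalRearrangement _ _)).pow_const _).div ENNReal.measurable_ofReal
    · dsimp only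
      gcongr
      exact maximalRearrangement_mono (hdom k) t
    · intro he
      rw [lorentzNorm, if_neg hq, he, ENNReal.top_rpow_of_pos (by positivity)] at hg
      exact lt_irrefl _ hg
    · filter_upwards [ae_restrict_mem measurableSet_Ioi] with t ht
      have h1 := ENNReal.Tendsto.const_mul (a := ENNReal.ofReal t ^ (1 / p)) (hm t ht)
        (Or.inr (ENNReal.rpow_ne_top_of_nonneg (by positivity) (by simp)))
      have h2 := (ENNReal.continuous_rpow_const (y := q.toReal)).continuousAt.tendsto.comp h1
      have h3 := ENNReal.Tendsto.div_const (b := ENNReal.ofReal t) h2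
        (Or.inr (by simpa using ht))
      simpa [hQ] using h3
  have h4 := (ENNReal.continuous_rpow_const (y := 1 / q.toReal)).continuousAt.tendsto.comp hI
  simp only [lintegral_zero, ENNReal.zero_rpow_of_pos (show 0 < 1 / q.toReal by positivity)] at h4
  refine h4.congr fun k => ?_
  rw [lorentzNorm, if_neg hq, Function.comp]

end LorentzLemmas

/-! ### Vector fields from their components -/

section FiniteSums

variable {X F : Type*} [MeasurableSpace X] [NormedAddCommGroup F]
variable {G : Type*} [NormedAddCommGroup G]

theorem setLIntegral_Ioo_comp_div (φ : ℝ → ℝ≥0∞) {c : ℝ} (hc : 0 < c) (t : ℝ) :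
    ∫⁻ s in Ioo 0 t, φ (s / c) = ENNReal.ofReal c * ∫⁻ s in Ioo 0 (t / c), φ s := by
  have him : (fun s : ℝ => s * c) '' Ioo 0 (t / c) = Ioo 0 t := by
    rw [image_mul_right_Ioo _ _ hc, zero_mul, div_mul_cancel₀ _ hc.ne']
  rw [← him, lintegral_image_eq_lintegral_abs_deriv_mul measurableSet_Ioo
    (fun x _ => (by simpa using (hasDerivAt_id x).mul_const c :
      HasDerivAt (fun s : ℝ => s * c) c x).hasDerivWithinAt)
    (fun a _ b _ h => mul_right_cancel₀ hc.ne' h), ← lintegral_const_mul' _ _ (by simp)]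
  refine lintegral_congr fun s => ?_
  rw [abs_of_pos hc, mul_div_cancel_right₀ _ hc.ne']

/-- If a sum of N terms exceeds Ns, some term exceeds s; so the level set at Ns is covered by N
level sets, each of measure at most t/N. The crude constants replace a triangle inequality, as only
finiteness is wanted in the end. -/
theorem rearrangement_le_of_enorm_le_sum {ι : Type*} [Fintype ι] [Nonempty ι] {μ : Measure X}
    {f : X → F} {w : ι → X → G} (h : ∀ᵐ x ∂μ, ‖f x‖ₑ ≤ ∑ i, ‖w i x‖ₑ) (t : ℝ) :
    rearrangement μ f t ≤
      Fintype.card ι * ∑ i, rearrangement μ (w i) (t / Fintype.card ι) := by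
  have hN : (Fintype.card ι : ℝ≥0∞) ≠ 0 := by simp
  have hN' : (Fintype.card ι : ℝ≥0∞) ≠ ⊤ := by simp
  rw [mul_comm, ← ENNReal.div_le_iff hN hN']
  refine le_of_forall_gt_imp_ge_of_dense fun s hs => ?_
  rw [ENNReal.div_le_iff hN hN']
  refine rearrangement_le ?_
  have hi : ∀ i, distribution μ (w i) s ≤ ENNReal.ofReal (t / Fintype.card ι) := by
    intro i
    have h1 : rearrangement μ (w i) (t / Fintype.card ι) < s :=
      lt_of_le_of_lt (Finset.single_le_sum (f := fun i => rearrangement μ (w i) _)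
        (fun _ _ => zero_le) (Finset.mem_univ i)) hs
    obtain ⟨s', hs', hlt⟩ := sInf_lt_iff.1 h1
    exact (distribution_antitone μ (w i) hlt.le).trans hs'
  calc distribution μ f (s * Fintype.card ι) ≤ μ (⋃ i, {x | s < ‖w i x‖ₑ}) := by
        refine measure_mono_ae ?_
        filter_upwards [h] with x hx (hs : _ < _)
        refine mem_iUnion.2 ?_
        by_contra! hcon
        refine absurd (hs.trans_le hx) (not_lt.2 ?_)
        calc ∑ i, ‖w i x‖ₑ ≤ ∑ _i : ι, s :=
              Finset.sum_le_sum fun i _ => not_lt.1 (hcon i)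
          _ = s * Fintype.card ι := by simp [mul_comm]
    _ ≤ ∑ i, distribution μ (w i) s := measure_iUnion_fintype_le _ _
    _ ≤ ∑ _i : ι, ENNReal.ofReal (t / Fintype.card ι) := Finset.sum_le_sum fun i _ => hi i
    _ = ENNReal.ofReal t := by
        rw [Finset.sum_const, nsmul_eq_mul, Finset.card_univ, ← ENNReal.ofReal_natCast,
          ← ENNReal.ofReal_mul (by positivity), mul_div_cancel₀ _ (by simp)]

theorem maximalRearrangement_le_of_enorm_le_sum {ι : Type*} [Fintype ι] [Nonempty ι]
    {μ : Measure X} {f : X → F} {w : ι → X → G}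
    (h : ∀ᵐ x ∂μ, ‖f x‖ₑ ≤ ∑ i, ‖w i x‖ₑ) {t : ℝ} (ht : 0 < t) :
    maximalRearrangement μ f t ≤
      (Fintype.card ι * Fintype.card ι) * ∑ i, maximalRearrangement μ (w i) t := by
  have hN : (0 : ℝ) < Fintype.card ι := by exact_mod_cast Fintype.card_pos
  have hN1 : (1 : ℝ) ≤ Fintype.card ι := by exact_mod_cast Fintype.card_pos
  simp only [maximalRearrangement, div_eq_mul_inv]
  rw [← Finset.sum_mul, ← mul_assoc]
  refine mul_le_mul_left ?_ _
  calc _ ≤ ∫⁻ s in Ioo 0 t, Fintype.card ι * ∑ i, rearrangement μ (w i) (s / Fintype.card ι) :=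
        lintegral_mono fun s => rearrangement_le_of_enorm_le_sum h s
    _ = Fintype.card ι * ∑ i, ∫⁻ s in Ioo 0 t, rearrangement μ (w i) (s / Fintype.card ι) := by
        rw [lintegral_const_mul' _ _ (by simp), lintegral_finsetSum]
        exact fun i _ => (measurable_rearrangement _ _).comp (measurable_id.div_const _)
    _ ≤ Fintype.card ι * ∑ i, Fintype.card ι * ∫⁻ s in Ioo 0 t, rearrangement μ (w i) s := by
        gcongr with i
        rw [setLIntegral_Ioo_comp_div _ hN, ENNReal.ofReal_natCast]
        gcongr
        exact div_le_self ht.le hN1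
    _ = _ := by rw [← Finset.mul_sum, mul_assoc]

theorem lorentzNorm_lt_top_of_enorm_le_sum {ι : Type*} [Fintype ι] [Nonempty ι]
    {μ : Measure X} {f : X → F} {w : ι → X → G} {p : ℝ} {q : ℝ≥0∞} (hq1 : 1 ≤ q) (hq : q ≠ ⊤)
    (h : ∀ᵐ x ∂μ, ‖f x‖ₑ ≤ ∑ i, ‖w i x‖ₑ) (hw : ∀ i, lorentzNorm μ p q (w i) < ⊤) :
    lorentzNorm μ p q f < ⊤ := by
  have hQ1 : 1 ≤ q.toReal := by
    simpa using (ENNReal.toReal_le_toReal ENNReal.one_ne_top hq).2 hq1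
  have hQ : 0 < q.toReal := by linarith
  simp only [lorentzNorm, if_neg hq] at hw ⊢
  refine ENNReal.rpow_lt_top_of_nonneg (by positivity) (ne_of_lt ?_)
  set N : ℝ≥0∞ := (Fintype.card ι : ℝ≥0∞)
  have hNt : N * N ≠ ⊤ := by simp [N, ENNReal.mul_eq_top]
  have hc : (N * N) ^ q.toReal * N ^ (q.toReal - 1) ≠ ⊤ :=
    ENNReal.mul_ne_top (ENNReal.rpow_ne_top_of_nonneg hQ.le hNt)
      (ENNReal.rpow_ne_top_of_nonneg (by linarith) (by simp [N]))
  calc _ ≤ ∫⁻ t in Ioi (0 : ℝ), ((N * N) ^ q.toReal * N ^ (q.toReal - 1)) *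
        ∑ i, (ENNReal.ofReal t ^ (1 / p) * maximalRearrangement μ (w i) t) ^ q.toReal
          / ENNReal.ofReal t := by
        refine setLIntegral_mono' measurableSet_Ioi fun t ht => ?_
        simp only [div_eq_mul_inv _ (ENNReal.ofReal t)]
        rw [← Finset.sum_mul, ← mul_assoc]
        refine mul_le_mul_left ?_ _
        calc _ ≤ ((N * N) * ∑ i, ENNReal.ofReal t ^ (1 / p) *
                maximalRearrangement μ (w i) t) ^ q.toReal := by
              refine ENNReal.rpow_le_rpow ?_ hQ.le
              rw [← Finset.mul_sum, mul_left_comm]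
              exact mul_le_mul_right (maximalRearrangement_le_of_enorm_le_sum h ht) _
          _ ≤ _ := by
              rw [ENNReal.mul_rpow_of_nonneg _ _ hQ.le, mul_assoc]
              exact mul_le_mul_right (ENNReal.rpow_sum_le_const_mul_sum_rpow _ _ hQ1) _
    _ = ((N * N) ^ q.toReal * N ^ (q.toReal - 1)) * ∑ i, ∫⁻ t in Ioi (0 : ℝ),
        (ENNReal.ofReal t ^ (1 / p) * maximalRearrangement μ (w i) t) ^ q.toReal
          / ENNReal.ofReal t := by
        rw [lintegral_const_mul' _ _ hc, lintegral_finsetSum]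
        exact fun i _ => (((ENNReal.measurable_ofReal.pow_const _).mul
          (measurable_maximalRearrangement _ _)).pow_const _).div ENNReal.measurable_ofReal
    _ < ⊤ := by
        refine ENNReal.mul_lt_top hc.lt_top (ENNReal.sum_lt_top.2 fun i _ => ?_)
        exact (ENNReal.rpow_lt_top_iff_of_pos (by positivity)).1 (hw i)

end FiniteSums

/-! ### The radial profile and the exact range of finite Lorentz norms -/

section Profile

variable {n : ℕ} {r α p : ℝ}

theorem unitBallVolume_pos (n : ℕ) : 0 < unitBallVolume n :=
  ENNReal.toReal_pos (Metric.measure_ball_pos _ _ one_pos).ne' measure_ball_lt_top.ne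

/-- The argument `ln(Ω_n r^n e^{pα} / t)` of the profile. -/
def logArg (r α : ℝ) (n : ℕ) (p t : ℝ) : ℝ :=
  Real.log (unitBallVolume n * r ^ n * Real.exp (p * α) / t)

theorem logArg_eq (hr : 0 < r) {t : ℝ} (ht : 0 < t) :
    logArg r α n p t = Real.log (unitBallVolume n * r ^ n) + p * α - Real.log t := by
  have hω := unitBallVolume_pos n
  rw [logArg, Real.log_div (by positivity) ht.ne', Real.log_mul (by positivity) (by positivity),
    Real.log_exp]

theorem le_logArg (hr : 0 < r) {t : ℝ} (ht : 0 < t) (ht' : t ≤ unitBallVolume n * r ^ n) :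
    p * α ≤ logArg r α n p t := by
  rw [logArg_eq hr ht]
  linarith [Real.log_le_log ht ht']

theorem logArg_antitone (hr : 0 < r) {s t : ℝ} (hs : 0 < s) (hst : s ≤ t) :
    logArg r α n p t ≤ logArg r α n p s := by
  rw [logArg_eq hr hs, logArg_eq hr (hs.trans_le hst)]
  linarith [Real.log_le_log hs hst]

theorem uProfile_pos (hr : 0 < r) (hp : 1 < p) (hα : 0 < α) {t : ℝ} (ht : 0 < t)
    (ht' : t ≤ unitBallVolume n * r ^ n) : 0 < uProfile r α n p t := by
  have hL : 0 < logArg r α n p t := lt_of_lt_of_le (by positivity) (le_logArg hr ht ht')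
  exact mul_pos (Real.rpow_pos_of_pos ht _) (Real.rpow_pos_of_pos hL _)

/-- The logarithmic derivative of u in ln t is -1/p + α/L, which is nonpositive exactly when L ≥ pα.
The factor e^(pα) in the definition guarantees this up to t = Ω_n r^n. -/
theorem uProfile_antitone (hr : 0 < r) (hp : 1 < p) (hα : 0 < α) {s t : ℝ} (hs : 0 < s)
    (hst : s ≤ t) (ht' : t ≤ unitBallVolume n * r ^ n) :
    uProfile r α n p t ≤ uProfile r α n p s := by
  have ht := hs.trans_le hst
  have hpα : 0 < p * α := by positivity
  have h1 := le_logArg (α := α) (p := p) hr ht ht'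
  have h2 := logArg_antitone (α := α) (p := p) (n := n) hr hs hst
  have hLt := hpα.trans_le h1
  have hLs := hLt.trans_le h2
  have h3 : logArg r α n p s - logArg r α n p t = Real.log t - Real.log s := by
    rw [logArg_eq hr hs, logArg_eq hr ht]; ring
  rw [← Real.log_le_log_iff (uProfile_pos hr hp hα ht ht')
    (uProfile_pos hr hp hα hs (hst.trans ht'))]
  have hlog : ∀ t, 0 < t → 0 < logArg r α n p t → Real.log (uProfile r α n p t) =
      -(1 / p) * Real.log t + -α * Real.log (logArg r α n p t) := by
    intro t ht hL
    rw [uProfile, ← logArg, Real.log_mul (Real.rpow_pos_of_pos ht _).ne'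
      (Real.rpow_pos_of_pos hL _).ne', Real.log_rpow ht, Real.log_rpow hL]
  rw [hlog t ht hLt, hlog s hs hLs]
  -- A derivative-free form: ln a ≤ a - 1 with a = L(s)/L(t), then L(t) ≥ pα.
  have h4 : Real.log (logArg r α n p s) - Real.log (logArg r α n p t) ≤
      (Real.log t - Real.log s) / (p * α) := by
    rw [← Real.log_div hLs.ne' hLt.ne']
    refine (Real.log_le_sub_one_of_pos (by positivity)).trans ?_
    rw [← h3, div_sub_one hLt.ne']
    exact div_le_div_of_nonneg_left (by linarith) hpα h1
  have h5 := mul_le_mul_of_nonneg_left h4 hα.le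
  have h6 : α * ((Real.log t - Real.log s) / (p * α)) = 1 / p * (Real.log t - Real.log s) := by
    field_simp
  rw [h6] at h5
  linarith

/-- The radial profile `u_rad`, extended by zero outside `(0, r)`. -/
def gRad (r α : ℝ) (n : ℕ) (p : ℝ) : ℝ → ℝ :=
  (Ioo 0 r).indicator (uRad r α n p)

/-- The modulus of the gradient of `v`. -/
def gradModulus (r α : ℝ) (n : ℕ) (p : ℝ) (x : EuclideanSpace ℝ (Fin n)) : ℝ :=
  gRad r α n p ‖x‖

theorem volume_ball_zero (hn : 1 ≤ n) {ρ : ℝ} (hρ : 0 ≤ ρ) :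
    volume (Metric.ball (0 : EuclideanSpace ℝ (Fin n)) ρ) =
      ENNReal.ofReal (unitBallVolume n * ρ ^ n) := by
  have : NeZero n := ⟨by omega⟩
  rw [Measure.addHaar_ball _ _ hρ, finrank_euclideanSpace_fin, unitBallVolume, mul_comm,
    ENNReal.ofReal_mul ENNReal.toReal_nonneg, ENNReal.ofReal_toReal measure_ball_lt_top.ne]

theorem exists_radius (hn : 1 ≤ n) (hr : 0 < r) {t : ℝ} (ht : 0 < t)
    (ht' : t < unitBallVolume n * r ^ n) : ∃ ρ, 0 < ρ ∧ ρ < r ∧ unitBallVolume n * ρ ^ n = t := by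
  have hω := unitBallVolume_pos n
  have hn0 : (n : ℝ) ≠ 0 := by positivity
  have h0 : 0 < t / unitBallVolume n := by positivity
  have h1 : ((t / unitBallVolume n) ^ (1 / (n : ℝ))) ^ n = t / unitBallVolume n := by
    rw [← Real.rpow_natCast, ← Real.rpow_mul h0.le, one_div_mul_cancel hn0, Real.rpow_one]
  refine ⟨(t / unitBallVolume n) ^ (1 / (n : ℝ)), by positivity, ?_, ?_⟩
  · refine lt_of_pow_lt_pow_left₀ n hr.le ?_
    rw [h1, div_lt_iff₀ hω]
    linarith
  · rw [h1]; field_simp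

theorem uRad_pos (hr : 0 < r) (hp : 1 < p) (hα : 0 < α) {s : ℝ} (hs : 0 < s) (hs' : s ≤ r) :
    0 < uRad r α n p s := by
  have hω := unitBallVolume_pos n
  exact uProfile_pos hr hp hα (by positivity) (by gcongr)

theorem uRad_antitone (hr : 0 < r) (hp : 1 < p) (hα : 0 < α) {s t : ℝ} (hs : 0 < s)
    (hst : s ≤ t) (ht' : t ≤ r) : uRad r α n p t ≤ uRad r α n p s := by
  have hω := unitBallVolume_pos n
  have ht := hs.trans_le hst
  exact uProfile_antitone hr hp hα (by positivity) (by gcongr) (by gcongr)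

theorem gRad_nonneg (hr : 0 < r) (hp : 1 < p) (hα : 0 < α) (s : ℝ) : 0 ≤ gRad r α n p s :=
  indicator_nonneg (fun _ hs => (uRad_pos hr hp hα hs.1 hs.2.le).le) s

theorem enorm_gradModulus (hr : 0 < r) (hp : 1 < p) (hα : 0 < α)
    (x : EuclideanSpace ℝ (Fin n)) :
    ‖gradModulus r α n p x‖ₑ = ENNReal.ofReal (gradModulus r α n p x) :=
  Real.enorm_of_nonneg (gRad_nonneg hr hp hα _)

/-- Writing t as the volume of B(0, ρ), the superlevel set at height u_rad(ρ) lies in that ball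
because u_rad decreases. -/
theorem rearrangement_gradModulus_le (hn : 1 ≤ n) (hr : 0 < r) (hp : 1 < p) (hα : 0 < α) {t : ℝ}
    (ht : 0 < t) (ht' : t < unitBallVolume n * r ^ n) :
    rearrangement volume (gradModulus r α n p) t ≤ ENNReal.ofReal (uProfile r α n p t) := by
  obtain ⟨ρ, hρ, hρr, rfl⟩ := exists_radius hn hr ht ht'
  refine rearrangement_le ?_
  rw [← volume_ball_zero hn hρ.le]
  refine measure_mono fun x hx => ?_
  have hx : ENNReal.ofReal (uRad r α n p ρ) < ‖gradModulus r α n p x‖ₑ := hx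
  rw [enorm_gradModulus hr hp hα, ENNReal.ofReal_lt_ofReal_iff_of_nonneg
    (uRad_pos hr hp hα hρ hρr.le).le, gradModulus, gRad] at hx
  rw [mem_ball_zero_iff]
  by_contra hcon
  by_cases hm : ‖x‖ ∈ Ioo 0 r
  · rw [indicator_of_mem hm] at hx
    exact absurd hx (not_lt.2 (uRad_antitone hr hp hα hρ (not_lt.1 hcon) hm.2.le))
  · rw [indicator_of_notMem hm] at hx
    exact absurd hx (not_lt.2 (uRad_pos hr hp hα hρ hρr.le).le)

theorem rearrangement_gradModulus_eq_zero (hn : 1 ≤ n) (hr : 0 < r) {t : ℝ}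
    (ht' : unitBallVolume n * r ^ n ≤ t) :
    rearrangement volume (gradModulus r α n p) t = 0 := by
  refine le_antisymm (rearrangement_le ?_) zero_le
  refine le_trans ?_ (ENNReal.ofReal_le_ofReal ht')
  rw [← volume_ball_zero hn hr.le]
  refine measure_mono fun x hx => ?_
  have hx : 0 < ‖gradModulus r α n p x‖ₑ := hx
  rw [mem_ball_zero_iff]
  by_contra hcon
  rw [gradModulus, gRad, indicator_of_notMem (fun h => hcon h.2)] at hx
  simp at hx

/-- The matching lower bound is stated with s < t: every level below u(t) is exceeded on the
punctured ball of volume t > s. It is used with s ranging over (0, t), to get f**(t) ≥ u(t). -/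
theorem le_rearrangement_gradModulus (hn : 1 ≤ n) (hr : 0 < r) (hp : 1 < p) (hα : 0 < α)
    {s t : ℝ} (hs : 0 < s) (hst : s < t) (ht' : t < unitBallVolume n * r ^ n) :
    ENNReal.ofReal (uProfile r α n p t) ≤ rearrangement volume (gradModulus r α n p) s := by
  have : NeZero n := ⟨by omega⟩
  obtain ⟨ρ, hρ, hρr, rfl⟩ := exists_radius hn hr (hs.trans hst) ht'
  refine le_of_forall_lt_imp_le_of_dense fun a ha => le_rearrangement ?_
  calc ENNReal.ofReal s < ENNReal.ofReal (unitBallVolume n * ρ ^ n) :=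
        (ENNReal.ofReal_lt_ofReal_iff_of_nonneg hs.le).2 hst
    _ = volume (Metric.ball (0 : EuclideanSpace ℝ (Fin n)) ρ \ {0}) := by
        rw [← volume_ball_zero hn hρ.le, measure_sdiff_null (measure_singleton _)]
    _ ≤ _ := by
        refine measure_mono fun x hx => ?_
        have h1 : ‖x‖ < ρ := mem_ball_zero_iff.1 hx.1
        have h2 : 0 < ‖x‖ := norm_pos_iff.2 hx.2
        change a < ‖gradModulus r α n p x‖ₑ
        rw [enorm_gradModulus hr hp hα, gradModulus, gRad,
          indicator_of_mem (show ‖x‖ ∈ Ioo 0 r from ⟨h2, h1.trans hρr⟩)]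
        exact ha.trans_le (ENNReal.ofReal_le_ofReal (uRad_antitone hr hp hα h2 h1.le hρr.le))

theorem setLIntegral_rpow_Ioo (hp : 1 < p) {t : ℝ} (ht : 0 < t) :
    ∫⁻ s in Ioo 0 t, ENNReal.ofReal (s ^ (-(1 / p))) =
      ENNReal.ofReal (t ^ (1 - 1 / p) / (1 - 1 / p)) := by
  have h1 : 1 / p < 1 := by rw [div_lt_one (by linarith)]; exact hp
  have hint : IntervalIntegrable (fun s : ℝ => s ^ (-(1 / p))) volume 0 t :=
    intervalIntegral.intervalIntegrable_rpow' (by linarith)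
  rw [setLIntegral_congr Ioo_ae_eq_Ioc, ← ofReal_integral_eq_lintegral_ofReal
    ((intervalIntegrable_iff_integrableOn_Ioc_of_le ht.le).1 hint),
    ← intervalIntegral.integral_of_le ht.le, integral_rpow (Or.inl (by linarith)),
    Real.zero_rpow (by linarith)]
  · congr 1; ring_nf
  · filter_upwards [ae_restrict_mem measurableSet_Ioc] with s hs
    exact Real.rpow_nonneg hs.1.le _

/-- On (0, t) the factor L^(-α) is largest at t and can be pulled out. The remaining power s^(-1/p)
is integrable at 0 because p > 1, which yields the constant 1/(1 - 1/p). -/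
theorem rpow_mul_maximalRearrangement_gradModulus_le (hn : 1 ≤ n) (hr : 0 < r) (hp : 1 < p)
    (hα : 0 < α) {t : ℝ} (ht : 0 < t) (ht' : t < unitBallVolume n * r ^ n) :
    ENNReal.ofReal t ^ (1 / p) * maximalRearrangement volume (gradModulus r α n p) t ≤
      ENNReal.ofReal (1 / (1 - 1 / p) * logArg r α n p t ^ (-α)) := by
  have h1 : 1 / p < 1 := by rw [div_lt_one (by linarith)]; exact hp
  have hL : 0 < logArg r α n p t := lt_of_lt_of_le (by positivity) (le_logArg hr ht ht'.le)
  have hI : ∫⁻ s in Ioo 0 t, rearrangement volume (gradModulus r α n p) s ≤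
      ENNReal.ofReal (logArg r α n p t ^ (-α)) *
        ENNReal.ofReal (t ^ (1 - 1 / p) / (1 - 1 / p)) := by
    rw [← setLIntegral_rpow_Ioo hp ht, ← lintegral_const_mul' _ _ (by simp)]
    refine setLIntegral_mono' measurableSet_Ioo fun s hs => ?_
    refine (rearrangement_gradModulus_le hn hr hp hα hs.1 (hs.2.trans ht')).trans ?_
    rw [← ENNReal.ofReal_mul (by positivity), mul_comm]
    refine ENNReal.ofReal_le_ofReal
      (mul_le_mul_of_nonneg_left ?_ (Real.rpow_nonneg hs.1.le _))
    exact Real.rpow_le_rpow_of_nonpos hL (logArg_antitone hr hs.1 hs.2.le) (by linarith)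
  have h2 : (0 : ℝ) < 1 - 1 / p := by linarith
  calc _ ≤ ENNReal.ofReal t ^ (1 / p) * ((ENNReal.ofReal (logArg r α n p t ^ (-α)) *
        ENNReal.ofReal (t ^ (1 - 1 / p) / (1 - 1 / p))) / ENNReal.ofReal t) :=
        mul_le_mul_right (ENNReal.div_le_div_right hI _) _
    _ = _ := by
        rw [ENNReal.ofReal_rpow_of_pos ht, ← ENNReal.ofReal_mul (by positivity),
          ← ENNReal.ofReal_div_of_pos ht, ← ENNReal.ofReal_mul (by positivity)]
        congr 1
        rw [Real.rpow_sub ht, Real.rpow_one]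
        have : 0 < t ^ (1 / p) := Real.rpow_pos_of_pos ht _
        field_simp

theorem le_rpow_mul_maximalRearrangement_gradModulus (hn : 1 ≤ n) (hr : 0 < r) (hp : 1 < p)
    (hα : 0 < α) {t : ℝ} (ht : 0 < t) (ht' : t < unitBallVolume n * r ^ n) :
    ENNReal.ofReal (logArg r α n p t ^ (-α)) ≤
      ENNReal.ofReal t ^ (1 / p) * maximalRearrangement volume (gradModulus r α n p) t := by
  have hL : 0 < logArg r α n p t := lt_of_lt_of_le (by positivity) (le_logArg hr ht ht'.le)
  have hI : ENNReal.ofReal (uProfile r α n p t) * ENNReal.ofReal t ≤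
      ∫⁻ s in Ioo 0 t, rearrangement volume (gradModulus r α n p) s := by
    calc _ = ∫⁻ _ in Ioo 0 t, ENNReal.ofReal (uProfile r α n p t) := by
          rw [setLIntegral_const, Real.volume_Ioo, sub_zero]
      _ ≤ _ := setLIntegral_mono' measurableSet_Ioo fun s hs =>
          le_rearrangement_gradModulus hn hr hp hα hs.1 hs.2 ht'
  calc _ = ENNReal.ofReal t ^ (1 / p) * ENNReal.ofReal (uProfile r α n p t) := by
        rw [ENNReal.ofReal_rpow_of_pos ht, ← ENNReal.ofReal_mul (by positivity), uProfile,
          ← logArg, ← mul_assoc, ← Real.rpow_add ht, add_neg_cancel, Real.rpow_zero, one_mul]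
    _ ≤ _ := by
        refine mul_le_mul_right ?_ _
        rw [maximalRearrangement, ENNReal.le_div_iff_mul_le (Or.inl (by simpa using ht))
          (Or.inl (by simp))]
        exact hI

/-- Substitution t = C e^(-y) with C = Ω_n r^n e^(pα): the Jacobian cancels 1/t, and t = Ω_n r^n
corresponds to y = pα. -/
theorem setLIntegral_logArg (hr : 0 < r) (φ : ℝ → ℝ≥0∞) :
    ∫⁻ t in Ioo 0 (unitBallVolume n * r ^ n), φ (logArg r α n p t) / ENNReal.ofReal t =
      ∫⁻ y in Ioi (p * α), φ y := by
  have hω := unitBallVolume_pos n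
  set C := unitBallVolume n * r ^ n * Real.exp (p * α) with hC
  have hC0 : 0 < C := by positivity
  have him : (fun y : ℝ => C * Real.exp (-y)) '' Ioi (p * α) =
      Ioo 0 (unitBallVolume n * r ^ n) := by
    ext t
    constructor
    · rintro ⟨y, hy, rfl⟩
      refine ⟨by positivity, ?_⟩
      dsimp only
      rw [hC, mul_assoc, ← Real.exp_add]
      refine mul_lt_of_lt_one_right (by positivity) (Real.exp_lt_one_iff.2 ?_)
      linarith [show p * α < y from hy]
    · rintro ⟨h1, h2⟩
      refine ⟨logArg r α n p t, ?_, ?_⟩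
      · rw [mem_Ioi, logArg_eq hr h1]
        linarith [Real.log_lt_log h1 h2]
      · dsimp only
        rw [logArg, Real.exp_neg, Real.exp_log (by positivity)]
        field_simp
        exact hC
  rw [← him, lintegral_image_eq_lintegral_abs_deriv_mul measurableSet_Ioi
    (f' := fun y => -(C * Real.exp (-y))) (fun y _ => ?_) (fun a _ b _ h => ?_)]
  · refine lintegral_congr fun y => ?_
    have hpos : 0 < C * Real.exp (-y) := by positivity
    rw [logArg, ← hC, abs_neg, abs_of_pos hpos, show C / (C * Real.exp (-y)) = Real.exp y by
      rw [Real.exp_neg]; field_simp, Real.log_exp,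
      ENNReal.mul_div_cancel (by simpa using hpos) (by simp)]
  · have := ((hasDerivAt_neg y).exp.const_mul C).hasDerivWithinAt (s := Ioi (p * α))
    simpa using this
  · have := Real.exp_injective (mul_left_cancel₀ hC0.ne' h)
    linarith

/-- The part below M = Ω_n r^n reduces to ∫ y^(-αq) dy with αq > 1. Beyond M the rearrangement is
zero and f** decays like 1/t, so that part converges because p > 1. -/
theorem lorentzNorm_gradModulus_lt_top (hn : 1 ≤ n) (hr : 0 < r) (hp : 1 < p) (hα : 0 < α)
    {q : ℝ≥0∞} (hq : q ≠ ⊤) (hαq : ENNReal.ofReal (1 / α) < q) :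
    lorentzNorm volume p q (gradModulus r α n p) < ⊤ := by
  have hω := unitBallVolume_pos n
  have hαq' : 1 / α < q.toReal := (ENNReal.ofReal_lt_iff_lt_toReal (by positivity) hq).1 hαq
  have hQ : 0 < q.toReal := lt_trans (by positivity) hαq'
  have hαQ : 1 < α * q.toReal := by rwa [div_lt_iff₀' hα] at hαq'
  have h1 : 1 / p < 1 := by rw [div_lt_one (by linarith)]; exact hp
  have h2 : (0 : ℝ) < 1 - 1 / p := by linarith
  have hpα : 0 < p * α := by positivity
  set M := unitBallVolume n * r ^ n with hM
  have hM0 : 0 < M := by positivity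
  rw [lorentzNorm, if_neg hq]
  refine ENNReal.rpow_lt_top_of_nonneg (by positivity) (ne_of_lt ?_)
  have hsplit : Ioi (0 : ℝ) ⊆ Ioo 0 M ∪ Ici M := fun t ht => by
    rcases lt_or_ge t M with h | h
    exacts [Or.inl ⟨ht, h⟩, Or.inr h]
  refine (lintegral_mono_set hsplit).trans_lt ((lintegral_union_le _ _ _).trans_lt
    (ENNReal.add_lt_top.2 ⟨?_, ?_⟩))
  · calc _ ≤ ∫⁻ t in Ioo 0 M, (fun y : ℝ => ENNReal.ofReal (1 / (1 - 1 / p) * y ^ (-α)) ^ q.toReal)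
            (logArg r α n p t) / ENNReal.ofReal t := by
          refine setLIntegral_mono' measurableSet_Ioo fun t ht => ?_
          exact ENNReal.div_le_div_right (ENNReal.rpow_le_rpow
            (rpow_mul_maximalRearrangement_gradModulus_le hn hr hp hα ht.1 ht.2) hQ.le) _
      _ = ∫⁻ y in Ioi (p * α), ENNReal.ofReal (1 / (1 - 1 / p) * y ^ (-α)) ^ q.toReal :=
          setLIntegral_logArg hr
            (fun y => ENNReal.ofReal (1 / (1 - 1 / p) * y ^ (-α)) ^ q.toReal)
      _ = ∫⁻ y in Ioi (p * α), ENNReal.ofReal ((1 / (1 - 1 / p)) ^ q.toReal) *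
            ENNReal.ofReal (y ^ (-(α * q.toReal))) := by
          refine setLIntegral_congr_fun measurableSet_Ioi fun y hy => ?_
          have hy : 0 < y := hpα.trans hy
          rw [ENNReal.ofReal_rpow_of_nonneg (by positivity) hQ.le,
            Real.mul_rpow (by positivity) (by positivity), ENNReal.ofReal_mul (by positivity),
            ← Real.rpow_mul hy.le, neg_mul]
      _ < ⊤ := by
          rw [lintegral_const_mul' _ _ (by simp)]
          exact ENNReal.mul_lt_top (by simp)
            ((integrableOn_Ioi_rpow_of_lt (by linarith) hpα).lintegral_lt_top)
  -- A bounds all the integrals of f*, so f**(t) ≤ A/t and the integrand is at most a multiple of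
  -- t^((1/p - 1)q - 1).
  · set A := ∫⁻ s in Ioo 0 M, rearrangement volume (gradModulus r α n p) s with hA
    have hAt : A ≠ ⊤ := by
      refine ne_top_of_le_ne_top ?_ (setLIntegral_mono' measurableSet_Ioo fun s hs =>
        (rearrangement_gradModulus_le hn hr hp hα hs.1 hs.2).trans (ENNReal.ofReal_le_ofReal
          (mul_le_mul_of_nonneg_left (Real.rpow_le_rpow_of_nonpos hpα
            (le_logArg hr hs.1 hs.2.le) (by linarith : -α ≤ 0)) (Real.rpow_nonneg hs.1.le _))))
      simp only [ENNReal.ofReal_mul' (Real.rpow_nonneg hpα.le (-α))]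
      rw [lintegral_mul_const' _ _ (by simp), setLIntegral_rpow_Ioo hp hM0]
      exact ENNReal.mul_ne_top (by simp) (by simp)
    have hAle : ∀ t, ∫⁻ s in Ioo 0 t, rearrangement volume (gradModulus r α n p) s ≤ A := by
      intro t
      rw [hA, ← lintegral_indicator measurableSet_Ioo, ← lintegral_indicator measurableSet_Ioo]
      refine lintegral_mono fun s => ?_
      by_cases hs : s ∈ Ioo 0 t
      · by_cases hs' : s < M
        · rw [indicator_of_mem hs, indicator_of_mem (show s ∈ Ioo 0 M from ⟨hs.1, hs'⟩)]
        · rw [indicator_of_mem hs, rearrangement_gradModulus_eq_zero hn hr (not_lt.1 hs')]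
          exact zero_le
      · rw [indicator_of_notMem hs]; exact zero_le
    calc _ ≤ ∫⁻ t in Ici M, A ^ q.toReal *
            ENNReal.ofReal (t ^ ((1 / p - 1) * q.toReal - 1)) := by
          refine setLIntegral_mono' measurableSet_Ici fun t ht => ?_
          have ht : 0 < t := hM0.trans_le ht
          calc _ ≤ (ENNReal.ofReal t ^ (1 / p) * (A / ENNReal.ofReal t)) ^ q.toReal
                / ENNReal.ofReal t := ENNReal.div_le_div_right (ENNReal.rpow_le_rpow
                  (mul_le_mul_right (ENNReal.div_le_div_right (hAle t) _) _) hQ.le) _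
            _ = (A * ENNReal.ofReal (t ^ (1 / p - 1))) ^ q.toReal / ENNReal.ofReal t := by
                rw [Real.rpow_sub ht, Real.rpow_one, ENNReal.ofReal_div_of_pos ht,
                  ENNReal.ofReal_rpow_of_pos ht, ← mul_div_assoc, ← mul_div_assoc, mul_comm A]
            _ = _ := by
                rw [ENNReal.mul_rpow_of_nonneg _ _ hQ.le,
                  ENNReal.ofReal_rpow_of_nonneg (by positivity) hQ.le, ← Real.rpow_mul ht.le,
                  mul_div_assoc, ← ENNReal.ofReal_div_of_pos ht, Real.rpow_sub ht, Real.rpow_one]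
      _ < ⊤ := by
          have hlt : (1 / p - 1) * q.toReal - 1 < -1 := by nlinarith
          rw [lintegral_const_mul' _ _ (ENNReal.rpow_ne_top_of_nonneg hQ.le hAt),
            setLIntegral_congr Ioi_ae_eq_Ici.symm]
          exact ENNReal.mul_lt_top (ENNReal.rpow_lt_top_of_nonneg hQ.le hAt)
            ((integrableOn_Ioi_rpow_of_lt hlt hM0).lintegral_lt_top)

/-- Already the part near t = 0 diverges: it dominates ∫ y^(-αq) dy over (pα, ∞) with αq ≤ 1. -/
theorem lorentzNorm_gradModulus_eq_top (hn : 1 ≤ n) (hr : 0 < r) (hp : 1 < p) (hα : 0 < α)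
    {q : ℝ≥0∞} (hq1 : 1 ≤ q) (hαq : q ≤ ENNReal.ofReal (1 / α)) :
    lorentzNorm volume p q (gradModulus r α n p) = ⊤ := by
  have hq : q ≠ ⊤ := ne_top_of_le_ne_top (by simp) hαq
  have hQ : 0 < q.toReal := ENNReal.toReal_pos (zero_lt_one.trans_le hq1).ne' hq
  have hαQ : α * q.toReal ≤ 1 := by
    have := (ENNReal.le_ofReal_iff_toReal_le hq (by positivity)).1 hαq
    rwa [le_div_iff₀' hα] at this
  have hpα : 0 < p * α := by positivity
  rw [lorentzNorm, if_neg hq]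
  refine ENNReal.rpow_eq_top_iff_of_pos (by positivity) |>.2 (top_unique ?_)
  calc ⊤ = ∫⁻ y in Ioi (p * α), ENNReal.ofReal (y ^ (-(α * q.toReal))) := by
        by_contra hne
        have hint : IntegrableOn (fun y : ℝ => y ^ (-(α * q.toReal))) (Ioi (p * α)) := by
          refine (lintegral_ofReal_ne_top_iff_integrable ?_ ?_).1 (Ne.symm hne)
          · exact (measurable_id.pow_const _).aestronglyMeasurable
          · filter_upwards [ae_restrict_mem measurableSet_Ioi] with y hy
            exact Real.rpow_nonneg (hpα.trans hy).le _
        have := (integrableOn_Ioi_rpow_iff hpα).1 hint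
        linarith
    _ = ∫⁻ y in Ioi (p * α), ENNReal.ofReal (y ^ (-α)) ^ q.toReal := by
        refine setLIntegral_congr_fun measurableSet_Ioi fun y hy => ?_
        have hy : 0 < y := hpα.trans hy
        rw [ENNReal.ofReal_rpow_of_nonneg (by positivity) hQ.le, ← Real.rpow_mul hy.le, neg_mul]
    _ = ∫⁻ t in Ioo 0 (unitBallVolume n * r ^ n),
          (fun y : ℝ => ENNReal.ofReal (y ^ (-α)) ^ q.toReal) (logArg r α n p t)
            / ENNReal.ofReal t := (setLIntegral_logArg hr
            (fun y => ENNReal.ofReal (y ^ (-α)) ^ q.toReal)).symm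
    _ ≤ ∫⁻ t in Ioo 0 (unitBallVolume n * r ^ n), (ENNReal.ofReal t ^ (1 / p) *
          maximalRearrangement volume (gradModulus r α n p) t) ^ q.toReal / ENNReal.ofReal t := by
        refine setLIntegral_mono' measurableSet_Ioo fun t ht => ?_
        exact ENNReal.div_le_div_right (ENNReal.rpow_le_rpow
          (le_rpow_mul_maximalRearrangement_gradModulus hn hr hp hα ht.1 ht.2) hQ.le) _
    _ ≤ _ := lintegral_mono_set fun t ht => ht.1

end Profile

/-! ### Smooth approximation of v and of its gradient -/

section Approximation

variable {n : ℕ} {r α p : ℝ}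

theorem continuousOn_gradient {Ω : Set (EuclideanSpace ℝ (Fin n))} (hΩ : IsOpen Ω)
    {φ : EuclideanSpace ℝ (Fin n) → ℝ} (hφ : ContDiffOn ℝ ∞ φ Ω) :
    ContinuousOn (gradient φ) Ω :=
  (InnerProductSpace.toDual ℝ (EuclideanSpace ℝ (Fin n))).symm.continuous.comp_continuousOn
    (hφ.continuousOn_fderiv_of_isOpen hΩ (by simp))

/-- The dominating function vanishes off B(0, r), a set of finite measure, so convergence almost
everywhere upgrades to convergence in measure. `F` is generic in order to serve both v and ∇v. -/
theorem tendsto_lorentzNorm_of_le_gradModulus {F : Type*} [NormedAddCommGroup F]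
    (hn : 1 ≤ n) (hr : 0 < r) (hp : 1 < p)
    (hα : 0 < α) {q : ℝ≥0∞} (hq1 : 1 ≤ q) (hq : q ≠ ⊤) (hαq : ENNReal.ofReal (1 / α) < q)
    {D : ℕ → EuclideanSpace ℝ (Fin n) → F} (hD : ∀ k, AEStronglyMeasurable (D k) volume)
    {c : ℝ} (hc : 0 < c) (hle : ∀ k, ∀ᵐ x, ‖D k x‖ ≤ c * gradModulus r α n p x)
    (hlim : ∀ᵐ x, Tendsto (fun k => D k x) atTop (𝓝 0)) :
    Tendsto (fun k => lorentzNorm volume p q (D k)) atTop (𝓝 0) := by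
  have hg : ∀ x, 0 ≤ gradModulus r α n p x := fun x => gRad_nonneg hr hp hα _
  refine tendsto_lorentzNorm_of_dominated (g := fun x => c * gradModulus r α n p x)
    (by linarith) hq1 hq ?_ (fun k => distribution_mono_ae ?_) fun ε hε => ?_
  · refine lt_of_le_of_lt (lorentzNorm_le_const_mul_of_enorm_le (g := gradModulus r α n p)
      (c := ENNReal.ofReal c) hq1 (by simpa using hc) (by simp) (Eventually.of_forall fun x => ?_))
      (ENNReal.mul_lt_top (by simp) (lorentzNorm_gradModulus_lt_top hn hr hp hα hq hαq))
    rw [enorm_mul, Real.enorm_of_nonneg hc.le]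
  · filter_upwards [hle k] with x hx
    rw [Real.enorm_of_nonneg (mul_nonneg hc.le (hg x)), ← ofReal_norm]
    exact ENNReal.ofReal_le_ofReal hx
  · have : IsFiniteMeasure ((volume : Measure (EuclideanSpace ℝ (Fin n))).restrict
        (Metric.ball 0 r)) := ⟨by simpa using measure_ball_lt_top⟩
    have hm := tendstoInMeasure_of_tendsto_ae (fun k => (hD k).restrict (s := Metric.ball 0 r))
      (ae_restrict_of_ae hlim)
    refine tendsto_of_tendsto_of_tendsto_of_le_of_le tendsto_const_nhds
      (hm ε (pos_iff_ne_zero.2 hε)) (fun _ => zero_le) fun k => ?_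
    dsimp only
    rw [Measure.restrict_apply' measurableSet_ball]
    refine measure_mono_ae ?_
    filter_upwards [hle k] with x hx (hε : ε < ‖D k x‖ₑ)
    refine ⟨?_, ?_⟩
    · change ε ≤ edist (D k x) 0
      rw [edist_zero_right]
      exact hε.le
    · rw [mem_ball_zero_iff]
      by_contra hcon
      rw [gradModulus, gRad, indicator_of_notMem (fun h => hcon h.2), mul_zero] at hx
      rw [norm_le_zero_iff.1 hx, enorm_zero] at hε
      exact not_lt_zero hε

/-- A smooth cutoff, compactly supported in `(0, r)` and tending to `1` there. -/
def cutoff (r : ℝ) (k : ℕ) (s : ℝ) : ℝ :=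
  Real.smoothTransition ((k + 1) * s - 1) * Real.smoothTransition ((k + 1) * (r - s) - 1)

theorem contDiff_cutoff (r : ℝ) (k : ℕ) : ContDiff ℝ ∞ (cutoff r k) :=
  (Real.smoothTransition.contDiff.comp (by fun_prop)).mul
    (Real.smoothTransition.contDiff.comp (by fun_prop))

theorem cutoff_nonneg (r : ℝ) (k : ℕ) (s : ℝ) : 0 ≤ cutoff r k s :=
  mul_nonneg (Real.smoothTransition.nonneg _) (Real.smoothTransition.nonneg _)

theorem cutoff_le_one (r : ℝ) (k : ℕ) (s : ℝ) : cutoff r k s ≤ 1 :=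
  mul_le_one₀ (Real.smoothTransition.le_one _) (Real.smoothTransition.nonneg _)
    (Real.smoothTransition.le_one _)

theorem cutoff_eq_zero_left {k : ℕ} {s : ℝ} (h : (k + 1) * s ≤ 1) : cutoff r k s = 0 := by
  rw [cutoff, Real.smoothTransition.zero_of_nonpos (by linarith), zero_mul]

theorem cutoff_eq_zero_right {k : ℕ} {s : ℝ} (h : (k + 1) * (r - s) ≤ 1) :
    cutoff r k s = 0 := by
  rw [cutoff, Real.smoothTransition.zero_of_nonpos (x := (k + 1) * (r - s) - 1) (by linarith),
    mul_zero]

theorem eventually_cutoff_eq_one {s : ℝ} (hs : 0 < s) (hs' : s < r) :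
    ∀ᶠ k : ℕ in atTop, cutoff r k s = 1 := by
  have h : ∀ {a : ℝ}, 0 < a → ∀ᶠ k : ℕ in atTop, 2 ≤ ((k : ℝ) + 1) * a := fun ha =>
    ((tendsto_natCast_atTop_atTop.atTop_add
      tendsto_const_nhds).atTop_mul_const ha).eventually_ge_atTop 2
  filter_upwards [h hs, h (sub_pos.2 hs')] with k h1 h2
  rw [cutoff, Real.smoothTransition.one_of_one_le (by linarith),
    Real.smoothTransition.one_of_one_le (by linarith), one_mul]

/-- The truncated radial profile. -/
def gCut (r α : ℝ) (n : ℕ) (p : ℝ) (k : ℕ) (s : ℝ) : ℝ :=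
  gRad r α n p s * cutoff r k s

theorem gCut_nonneg (hr : 0 < r) (hp : 1 < p) (hα : 0 < α) (k : ℕ) (s : ℝ) :
    0 ≤ gCut r α n p k s :=
  mul_nonneg (gRad_nonneg hr hp hα s) (cutoff_nonneg _ _ _)

theorem gCut_le (hr : 0 < r) (hp : 1 < p) (hα : 0 < α) (k : ℕ) (s : ℝ) :
    gCut r α n p k s ≤ gRad r α n p s :=
  mul_le_of_le_one_right (gRad_nonneg hr hp hα s) (cutoff_le_one _ _ _)

theorem eventually_gCut_eq (s : ℝ) : ∀ᶠ k : ℕ in atTop, gCut r α n p k s = gRad r α n p s := by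
  by_cases hs : s ∈ Ioo 0 r
  · filter_upwards [eventually_cutoff_eq_one hs.1 hs.2] with k hk
    rw [gCut, hk, mul_one]
  · exact Eventually.of_forall fun k => by rw [gCut, gRad, indicator_of_notMem hs, zero_mul]

theorem contDiffAt_uRad (hr : 0 < r) (hp : 1 < p) (hα : 0 < α) {s : ℝ} (hs : s ∈ Ioo 0 r) :
    ContDiffAt ℝ ∞ (uRad r α n p) s := by
  have hω := unitBallVolume_pos n
  have hs0 : 0 < s := hs.1
  have hL : 0 < logArg r α n p (unitBallVolume n * s ^ n) :=
    lt_of_lt_of_le (by positivity) (le_logArg hr (by positivity)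
      (by have := hs.2.le; gcongr))
  have hb : ContDiffAt ℝ ∞ (fun s : ℝ => unitBallVolume n * s ^ n) s := by fun_prop
  refine (hb.rpow_const_of_ne (by positivity)).mul (ContDiffAt.rpow_const_of_ne ?_ hL.ne')
  have hq : ContDiffAt ℝ ∞ (fun s : ℝ => unitBallVolume n * r ^ n * Real.exp (p * α) /
      (unitBallVolume n * s ^ n)) s := contDiffAt_const.div hb (by positivity)
  exact hq.log (by positivity)

/-- `gRad` is smooth only inside (0, r), but the cutoff vanishes in a neighbourhood of every point
outside it. -/
theorem contDiff_gCut (hr : 0 < r) (hp : 1 < p) (hα : 0 < α) (k : ℕ) :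
    ContDiff ℝ ∞ (gCut r α n p k) := by
  have hk : (0 : ℝ) < k + 1 := by positivity
  refine contDiff_iff_contDiffAt.2 fun s => ?_
  by_cases hs : s ∈ Ioo 0 r
  · refine ((contDiffAt_uRad (n := n) hr hp hα hs).mul
      (contDiff_cutoff r k).contDiffAt).congr_of_eventuallyEq ?_
    filter_upwards [isOpen_Ioo.mem_nhds hs] with t ht
    rw [gCut, gRad, indicator_of_mem ht]
  · refine (contDiffAt_const (c := (0 : ℝ))).congr_of_eventuallyEq ?_
    rcases le_or_gt s 0 with h | h
    · have : ∀ᶠ t : ℝ in 𝓝 s, ((k : ℝ) + 1) * t < 1 :=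
        (by fun_prop : Continuous fun t : ℝ => ((k : ℝ) + 1) * t).continuousAt.eventually_lt_const
          (by nlinarith)
      filter_upwards [this] with t ht
      rw [gCut, cutoff_eq_zero_left ht.le, mul_zero]
    · have hsr : r ≤ s := not_lt.1 fun h' => hs ⟨h, h'⟩
      have : ∀ᶠ t : ℝ in 𝓝 s, ((k : ℝ) + 1) * (r - t) < 1 :=
        (by fun_prop : Continuous fun t : ℝ => ((k : ℝ) + 1) * (r - t)).continuousAt.eventually_lt_const
          (by nlinarith)
      filter_upwards [this] with t ht
      rw [gCut, cutoff_eq_zero_right ht.le, mul_zero]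

/-- The smooth approximations of `v`. -/
def vApprox (r α : ℝ) (n : ℕ) (p : ℝ) (k : ℕ) (x : EuclideanSpace ℝ (Fin n)) : ℝ :=
  ∫ s in ‖x‖..r, gCut r α n p k s

/-- The gradient of `v`. -/
def gradV (r α : ℝ) (n : ℕ) (p : ℝ) (x : EuclideanSpace ℝ (Fin n)) : EuclideanSpace ℝ (Fin n) :=
  -(gRad r α n p ‖x‖ / ‖x‖) • x

theorem hasDerivAt_integral_gCut (hr : 0 < r) (hp : 1 < p) (hα : 0 < α) (k : ℕ) (ρ : ℝ) :
    HasDerivAt (fun ρ => ∫ s in ρ..r, gCut r α n p k s) (-gCut r α n p k ρ) ρ := by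
  have hc := (contDiff_gCut (n := n) hr hp hα k).continuous
  exact intervalIntegral.integral_hasDerivAt_left (hc.intervalIntegrable _ _)
    (hc.stronglyMeasurableAtFilter _ _) hc.continuousAt

theorem contDiff_integral_gCut (hr : 0 < r) (hp : 1 < p) (hα : 0 < α) (k : ℕ) :
    ContDiff ℝ ∞ (fun ρ => ∫ s in ρ..r, gCut r α n p k s) := by
  refine contDiff_infty_iff_deriv.2
    ⟨fun ρ => (hasDerivAt_integral_gCut hr hp hα k ρ).differentiableAt, ?_⟩
  have : deriv (fun ρ => ∫ s in ρ..r, gCut r α n p k s) = fun ρ => -gCut r α n p k ρ :=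
    funext fun ρ => (hasDerivAt_integral_gCut hr hp hα k ρ).deriv
  rw [this]
  exact (contDiff_gCut hr hp hα k).neg

/-- The norm is not smooth at the origin, but the truncated profile is zero near 0, so the function
is constant there. -/
theorem contDiff_vApprox (hr : 0 < r) (hp : 1 < p) (hα : 0 < α) (k : ℕ) :
    ContDiff ℝ ∞ (vApprox r α n p k) := by
  have hk : (0 : ℝ) < k + 1 := by positivity
  have hc := (contDiff_gCut (n := n) hr hp hα k).continuous
  refine contDiff_iff_contDiffAt.2 fun x => ?_
  rcases eq_or_ne x 0 with rfl | hx
  · refine (contDiffAt_const (c := ∫ s in (0 : ℝ)..r, gCut r α n p k s)).congr_of_eventuallyEq ?_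
    have : ∀ᶠ x : EuclideanSpace ℝ (Fin n) in 𝓝 0, (k + 1) * ‖x‖ < 1 :=
      (by fun_prop : Continuous fun x : EuclideanSpace ℝ (Fin n) =>
        (k + 1 : ℝ) * ‖x‖).continuousAt.eventually_lt_const (by simp)
    filter_upwards [this] with x hx
    rw [vApprox, ← intervalIntegral.integral_add_adjacent_intervals
      (hc.intervalIntegrable 0 ‖x‖) (hc.intervalIntegrable ‖x‖ r), right_eq_add]
    refine intervalIntegral.integral_zero_ae (Eventually.of_forall fun s hs => ?_)
    rw [uIoc_of_le (norm_nonneg _)] at hs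
    rw [gCut, cutoff_eq_zero_left (by nlinarith [hs.2]), mul_zero]
  · exact (contDiff_integral_gCut hr hp hα k).contDiffAt.comp x (contDiffAt_norm ℝ hx)

theorem vApprox_eq_zero {k : ℕ} {x : EuclideanSpace ℝ (Fin n)}
    (hx : (k + 1) * (r - ‖x‖) ≤ 1) : vApprox r α n p k x = 0 := by
  have hk : (0 : ℝ) < k + 1 := by positivity
  refine intervalIntegral.integral_zero_ae (Eventually.of_forall fun s hs => ?_)
  rw [gCut, cutoff_eq_zero_right, mul_zero]
  rcases le_total ‖x‖ r with h | h
  · rw [uIoc_of_le h] at hs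
    nlinarith [hs.1]
  · rw [uIoc_of_ge h] at hs
    nlinarith [hs.1]

theorem vApprox_mem_testFunctions (hr : 0 < r) (hp : 1 < p) (hα : 0 < α) (k : ℕ) :
    vApprox r α n p k ∈ testFunctions (Metric.ball (0 : EuclideanSpace ℝ (Fin n)) r) := by
  have hk : (0 : ℝ) < k + 1 := by positivity
  have h0 : ∀ x ∉ Metric.closedBall (0 : EuclideanSpace ℝ (Fin n)) (r - 1 / (k + 1)),
      vApprox r α n p k x = 0 := by
    intro x hx
    refine vApprox_eq_zero ?_
    rw [mem_closedBall_zero_iff, not_le] at hx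
    rw [← le_div_iff₀' hk]
    linarith
  refine ⟨contDiff_vApprox hr hp hα k, HasCompactSupport.intro (isCompact_closedBall _ _) h0,
    (closure_minimal (t := Metric.closedBall 0 (r - 1 / (k + 1))) (fun x hx => ?_)
      Metric.isClosed_closedBall).trans
      (Metric.closedBall_subset_ball (sub_lt_self r (by positivity)))⟩
  by_contra hcon
  exact hx (h0 x hcon)

theorem hasFDerivAt_norm_of_ne_zero {x : EuclideanSpace ℝ (Fin n)} (hx : x ≠ 0) :
    HasFDerivAt (fun y : EuclideanSpace ℝ (Fin n) => ‖y‖) (‖x‖⁻¹ • innerSL ℝ x) x := by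
  have h0 : 0 < ‖x‖ := norm_pos_iff.2 hx
  have h := (hasStrictFDerivAt_norm_sq x).hasFDerivAt.sqrt (by positivity)
  simp only [Real.sqrt_sq (norm_nonneg _)] at h
  refine h.congr_fderiv ?_
  ext y
  simp
  field_simp

theorem gradient_vApprox (hr : 0 < r) (hp : 1 < p) (hα : 0 < α) (k : ℕ)
    {x : EuclideanSpace ℝ (Fin n)} (hx : x ≠ 0) :
    gradient (vApprox r α n p k) x = -(gCut r α n p k ‖x‖ / ‖x‖) • x := by
  refine HasGradientAt.gradient ?_
  rw [hasGradientAt_iff_hasFDerivAt]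
  refine ((hasDerivAt_integral_gCut (n := n) hr hp hα k ‖x‖).comp_hasFDerivAt x
    (hasFDerivAt_norm_of_ne_zero hx)).congr_fderiv ?_
  ext y
  simp
  ring

theorem measurable_uRad : Measurable (uRad r α n p) := by
  unfold uRad uProfile
  fun_prop

theorem measurable_gRad : Measurable (gRad r α n p) :=
  measurable_uRad.indicator measurableSet_Ioo

theorem measurable_gradV : Measurable (gradV r α n p) := by
  have h : Measurable fun x : EuclideanSpace ℝ (Fin n) => gRad r α n p ‖x‖ :=
    measurable_gRad.comp measurable_norm
  exact ((h.div measurable_norm).neg).smul measurable_id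

theorem measurable_vReal : Measurable (vReal r α n p) := by
  have h : Measurable fun ρ : ℝ => ∫⁻ s in Ioo ρ r, ENNReal.ofReal (uRad r α n p s) :=
    Antitone.measurable fun a b hab => lintegral_mono_set (Ioo_subset_Ioo_left hab)
  exact (h.comp measurable_norm).ennreal_toReal

/-- This holds at x = 0 too: if the integral diverges, both sides take the default value 0. -/
theorem vReal_eq_integral (hr : 0 < r) (hp : 1 < p) (hα : 0 < α)
    (x : EuclideanSpace ℝ (Fin n)) :
    vReal r α n p x = ∫ s in Ioo ‖x‖ r, gRad r α n p s := by
  rw [integral_eq_lintegral_of_nonneg_ae (Eventually.of_forall (gRad_nonneg hr hp hα))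
    measurable_gRad.aestronglyMeasurable, vReal, v]
  congr 1
  refine setLIntegral_congr_fun measurableSet_Ioo fun s hs => ?_
  rw [gRad, indicator_of_mem (show s ∈ Ioo 0 r from ⟨(norm_nonneg x).trans_lt hs.1, hs.2⟩)]

theorem vApprox_eq_integral {x : EuclideanSpace ℝ (Fin n)} {k : ℕ} :
    vApprox r α n p k x = ∫ s in Ioo ‖x‖ r, gCut r α n p k s := by
  rcases le_total ‖x‖ r with h | h
  · rw [vApprox, intervalIntegral.integral_of_le h, integral_Ioc_eq_integral_Ioo]
  · rw [Ioo_eq_empty (not_lt.2 h), setIntegral_empty]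
    have hk : (0 : ℝ) < k + 1 := by positivity
    exact vApprox_eq_zero (by nlinarith)

theorem gRad_le_of_mem (hr : 0 < r) (hp : 1 < p) (hα : 0 < α) {ρ s : ℝ} (hρ : 0 < ρ)
    (hs : s ∈ Ioo ρ r) : gRad r α n p s ≤ gRad r α n p ρ := by
  rw [gRad, indicator_of_mem (show s ∈ Ioo 0 r from ⟨hρ.trans hs.1, hs.2⟩),
    indicator_of_mem (show ρ ∈ Ioo 0 r from ⟨hρ, hs.1.trans hs.2⟩)]
  exact uRad_antitone hr hp hα hρ hs.1.le hs.2.le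

theorem integrableOn_gRad (hr : 0 < r) (hp : 1 < p) (hα : 0 < α) {ρ : ℝ} (hρ : 0 < ρ) :
    IntegrableOn (gRad r α n p) (Ioo ρ r) := by
  refine Measure.integrableOn_of_bounded (M := gRad r α n p ρ) (by simp)
    measurable_gRad.aestronglyMeasurable ?_
  filter_upwards [ae_restrict_mem measurableSet_Ioo] with s hs
  rw [Real.norm_of_nonneg (gRad_nonneg hr hp hα s)]
  exact gRad_le_of_mem hr hp hα hρ hs

/-- As u_rad decreases, v(x) ≤ (r - |x|) u_rad(|x|) inside the ball. Thus v needs no Lorentz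
estimate of its own. -/
theorem vReal_le (hr : 0 < r) (hp : 1 < p) (hα : 0 < α) {x : EuclideanSpace ℝ (Fin n)}
    (hx : x ≠ 0) : vReal r α n p x ≤ r * gradModulus r α n p x := by
  have hρ : 0 < ‖x‖ := norm_pos_iff.2 hx
  have hg := gRad_nonneg (n := n) hr hp hα ‖x‖
  rw [vReal_eq_integral hr hp hα]
  calc _ ≤ ∫ _ in Ioo ‖x‖ r, gRad r α n p ‖x‖ :=
        setIntegral_mono_on (integrableOn_gRad hr hp hα hρ) (by simp) measurableSet_Ioo
          fun s hs => gRad_le_of_mem hr hp hα hρ hs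
    _ = max (r - ‖x‖) 0 * gRad r α n p ‖x‖ := by
        rw [setIntegral_const, smul_eq_mul, Measure.real, Real.volume_Ioo, ENNReal.toReal_ofReal']
    _ ≤ _ := mul_le_mul_of_nonneg_right (max_le (by linarith) hr.le) hg

theorem vApprox_nonneg (hr : 0 < r) (hp : 1 < p) (hα : 0 < α) (k : ℕ)
    (x : EuclideanSpace ℝ (Fin n)) : 0 ≤ vApprox r α n p k x := by
  rw [vApprox_eq_integral]
  exact integral_nonneg fun s => gCut_nonneg hr hp hα k s

theorem vApprox_le (hr : 0 < r) (hp : 1 < p) (hα : 0 < α) (k : ℕ)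
    {x : EuclideanSpace ℝ (Fin n)} (hx : x ≠ 0) : vApprox r α n p k x ≤ vReal r α n p x := by
  rw [vApprox_eq_integral, vReal_eq_integral hr hp hα]
  exact integral_mono_of_nonneg (Eventually.of_forall fun s => gCut_nonneg hr hp hα k s)
    (integrableOn_gRad hr hp hα (norm_pos_iff.2 hx))
    (Eventually.of_forall fun s => gCut_le hr hp hα k s)

theorem tendsto_vApprox (hr : 0 < r) (hp : 1 < p) (hα : 0 < α)
    {x : EuclideanSpace ℝ (Fin n)} (hx : x ≠ 0) :
    Tendsto (fun k => vApprox r α n p k x) atTop (𝓝 (vReal r α n p x)) := by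
  rw [vReal_eq_integral hr hp hα]
  simp only [vApprox_eq_integral]
  refine tendsto_integral_of_dominated_convergence (gRad r α n p)
    (fun k => (contDiff_gCut hr hp hα k).continuous.aestronglyMeasurable)
    (integrableOn_gRad hr hp hα (norm_pos_iff.2 hx))
    (fun k => Eventually.of_forall fun s => ?_)
    (Eventually.of_forall fun s => tendsto_const_nhds.congr' ?_)
  · rw [Real.norm_of_nonneg (gCut_nonneg hr hp hα k s)]
    exact gCut_le hr hp hα k s
  · filter_upwards [eventually_gCut_eq s] with k hk using hk.symm

theorem gradV_eq_zero {x : EuclideanSpace ℝ (Fin n)} (hx : r ≤ ‖x‖) : gradV r α n p x = 0 := by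
  rw [gradV, gRad, indicator_of_notMem (fun h => not_lt.2 hx h.2)]
  simp

theorem norm_gradV (hr : 0 < r) (hp : 1 < p) (hα : 0 < α) (x : EuclideanSpace ℝ (Fin n)) :
    ‖gradV r α n p x‖ = gradModulus r α n p x := by
  rcases eq_or_ne x 0 with rfl | hx
  · simp [gradV, gradModulus, gRad]
  · have h0 : 0 < ‖x‖ := norm_pos_iff.2 hx
    rw [gradV, norm_smul, norm_neg, norm_div, norm_norm, div_mul_cancel₀ _ h0.ne',
      Real.norm_of_nonneg (gRad_nonneg hr hp hα _), gradModulus]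

theorem tendsto_lorentzNorm_vReal_sub (hn : 1 ≤ n) (hr : 0 < r) (hp : 1 < p) (hα : 0 < α)
    {q : ℝ≥0∞} (hq1 : 1 ≤ q) (hq : q ≠ ⊤) (hαq : ENNReal.ofReal (1 / α) < q) :
    Tendsto (fun k => lorentzNorm volume p q (vReal r α n p - vApprox r α n p k)) atTop (𝓝 0) := by
  have : NeZero n := ⟨by omega⟩
  have hne : ∀ᵐ x : EuclideanSpace ℝ (Fin n), x ≠ 0 := by simp [ae_iff]
  refine tendsto_lorentzNorm_of_le_gradModulus hn hr hp hα hq1 hq hαq (fun k => ?_) hr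
    (fun k => ?_) ?_
  · exact (measurable_vReal.sub
      (contDiff_vApprox hr hp hα k).continuous.measurable).aestronglyMeasurable
  · filter_upwards [hne] with x hx
    have h1 := vApprox_nonneg (n := n) hr hp hα k x
    have h2 := vApprox_le hr hp hα k hx
    have h3 := vReal_le hr hp hα hx
    rw [Pi.sub_apply, Real.norm_of_nonneg (by linarith)]
    linarith
  · filter_upwards [hne] with x hx
    simpa using (tendsto_const_nhds (x := vReal r α n p x)).sub (tendsto_vApprox hr hp hα hx)

theorem tendsto_lorentzNorm_gradV_sub (hn : 1 ≤ n) (hr : 0 < r) (hp : 1 < p) (hα : 0 < α)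
    {q : ℝ≥0∞} (hq1 : 1 ≤ q) (hq : q ≠ ⊤) (hαq : ENNReal.ofReal (1 / α) < q) :
    Tendsto (fun k => lorentzNorm volume p q (gradV r α n p - gradient (vApprox r α n p k)))
      atTop (𝓝 0) := by
  have : NeZero n := ⟨by omega⟩
  have hne : ∀ᵐ x : EuclideanSpace ℝ (Fin n), x ≠ 0 := by simp [ae_iff]
  have heq : ∀ k, ∀ x : EuclideanSpace ℝ (Fin n), x ≠ 0 →
      (gradV r α n p - gradient (vApprox r α n p k)) x =
        -((gRad r α n p ‖x‖ - gCut r α n p k ‖x‖) / ‖x‖) • x := by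
    intro k x hx
    rw [Pi.sub_apply, gradient_vApprox hr hp hα k hx, gradV, ← sub_smul]
    congr 1
    ring
  refine tendsto_lorentzNorm_of_le_gradModulus hn hr hp hα hq1 hq hαq (fun k => ?_) one_pos
    (fun k => ?_) ?_
  · refine (measurable_gradV.sub ?_).aestronglyMeasurable
    exact (continuousOn_univ.1 (continuousOn_gradient isOpen_univ
      (contDiff_vApprox hr hp hα k).contDiffOn)).measurable
  · filter_upwards [hne] with x hx
    have h0 : 0 < ‖x‖ := norm_pos_iff.2 hx
    have h1 := gCut_nonneg (n := n) hr hp hα k ‖x‖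
    have h2 := gCut_le (n := n) hr hp hα k ‖x‖
    rw [heq k x hx, norm_smul, norm_neg, norm_div, norm_norm, div_mul_cancel₀ _ h0.ne',
      Real.norm_of_nonneg (by linarith), gradModulus]
    linarith
  · filter_upwards [hne] with x hx
    refine tendsto_const_nhds.congr' ?_
    filter_upwards [eventually_gCut_eq (r := r) (α := α) (n := n) (p := p) ‖x‖] with k hk
    rw [heq k x hx, hk, sub_self, zero_div, neg_zero, zero_smul]

theorem lorentzNorm_gradV (hr : 0 < r) (hp : 1 < p) (hα : 0 < α) {q : ℝ≥0∞} (hq1 : 1 ≤ q) :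
    lorentzNorm volume p q (gradV r α n p) = lorentzNorm volume p q (gradModulus r α n p) := by
  have h : ∀ x, ‖gradV r α n p x‖ₑ = ‖gradModulus r α n p x‖ₑ := fun x => by
    rw [enorm_gradModulus hr hp hα, ← ofReal_norm, norm_gradV hr hp hα]
  exact le_antisymm
    (lorentzNorm_mono hq1 (distribution_mono_ae (Eventually.of_forall fun x => (h x).le)))
    (lorentzNorm_mono hq1 (distribution_mono_ae (Eventually.of_forall fun x => (h x).ge)))

theorem lorentzNorm_vReal_lt_top (hn : 1 ≤ n) (hr : 0 < r) (hp : 1 < p) (hα : 0 < α)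
    {q : ℝ≥0∞} (hq1 : 1 ≤ q) (hq : q ≠ ⊤) (hαq : ENNReal.ofReal (1 / α) < q) :
    lorentzNorm volume p q (vReal r α n p) < ⊤ := by
  have : NeZero n := ⟨by omega⟩
  have hne : ∀ᵐ x : EuclideanSpace ℝ (Fin n), x ≠ 0 := by simp [ae_iff]
  refine (lorentzNorm_le_const_mul_of_enorm_le (g := gradModulus r α n p)
    (c := ENNReal.ofReal r) hq1 (by simpa using hr) (by simp) ?_).trans_lt
    (ENNReal.mul_lt_top (by simp) (lorentzNorm_gradModulus_lt_top hn hr hp hα hq hαq))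
  filter_upwards [hne] with x hx
  rw [enorm_gradModulus hr hp hα, ← ENNReal.ofReal_mul hr.le,
    Real.enorm_of_nonneg (show 0 ≤ vReal r α n p x from ENNReal.toReal_nonneg)]
  exact ENNReal.ofReal_le_ofReal (vReal_le hr hp hα hx)

end Approximation

/-! ### Weak derivatives: limits, uniqueness, and the inclusion of H in W -/

section WeakDerivatives

variable {n : ℕ} {p : ℝ} {q : ℝ≥0∞} {Ω : Set (EuclideanSpace ℝ (Fin n))}

theorem gradient_apply (φ : EuclideanSpace ℝ (Fin n) → ℝ) (x : EuclideanSpace ℝ (Fin n))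
    (i : Fin n) : gradient φ x i = fderiv ℝ φ x (EuclideanSpace.single i 1) := by
  rw [← InnerProductSpace.toDual_symm_apply (y := fderiv ℝ φ x), EuclideanSpace.inner_single_right]
  simp [gradient]

theorem MemLorentz.locallyIntegrableOn {F : Type*} [NormedAddCommGroup F] [MeasurableSpace F]
    [BorelSpace F] [SecondCountableTopology F] (hΩ : IsOpen Ω) (hp : 0 < p) (hq : 1 ≤ q)
    {w : EuclideanSpace ℝ (Fin n) → F} (hw : MemLorentz (volume.restrict Ω) p q w) :
    LocallyIntegrableOn w Ω := by
  rw [locallyIntegrableOn_iff hΩ.isLocallyClosed]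
  intro K hK hKc
  have : IsFiniteMeasure ((volume : Measure (EuclideanSpace ℝ (Fin n))).restrict K) :=
    ⟨by simpa using hKc.measure_lt_top⟩
  have hle : (volume : Measure (EuclideanSpace ℝ (Fin n))).restrict K ≤ volume.restrict Ω :=
    Measure.restrict_mono_set _ hK
  obtain ⟨C, hC, hCle⟩ := exists_lintegral_enorm_le_mul_lorentzNorm (F := F)
    ((volume : Measure (EuclideanSpace ℝ (Fin n))).restrict K) hp hq
  have hm := hw.1.mono_measure hle
  refine ⟨hm.aestronglyMeasurable, (hCle w hm.norm).trans_lt (ENNReal.mul_lt_top hC.lt_top ?_)⟩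
  exact (lorentzNorm_mono hq (distribution_mono_measure hle w)).trans_lt hw.2

/-- Multiplication by a compactly supported function maps `L^{(p,q)}(Ω)` to `L¹(Ω)`. -/
theorem exists_lintegral_mul_le (hp : 0 < p) (hq : 1 ≤ q) {ψ : EuclideanSpace ℝ (Fin n) → ℝ}
    (hψ : Continuous ψ) (hψc : HasCompactSupport ψ) (hψΩ : tsupport ψ ⊆ Ω) :
    ∃ C : ℝ≥0∞, C ≠ ⊤ ∧ ∀ w : EuclideanSpace ℝ (Fin n) → ℝ, AEMeasurable w (volume.restrict Ω) →
      ∫⁻ x in Ω, ‖ψ x * w x‖ₑ ≤ C * lorentzNorm (volume.restrict Ω) p q w := by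
  set K := tsupport ψ
  have : IsFiniteMeasure ((volume : Measure (EuclideanSpace ℝ (Fin n))).restrict K) :=
    ⟨by simpa using hψc.isCompact.measure_lt_top⟩
  have hle : (volume : Measure (EuclideanSpace ℝ (Fin n))).restrict K ≤ volume.restrict Ω :=
    Measure.restrict_mono_set _ hψΩ
  have hKm : MeasurableSet K := (isClosed_tsupport ψ).measurableSet
  obtain ⟨C, hC, hCle⟩ := exists_lintegral_enorm_le_mul_lorentzNorm (F := ℝ)
    ((volume : Measure (EuclideanSpace ℝ (Fin n))).restrict K) hp hq
  obtain ⟨M, hM⟩ := hψc.exists_bound_of_continuous hψ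
  refine ⟨ENNReal.ofReal M * C, ENNReal.mul_ne_top (by simp) hC, fun w hw => ?_⟩
  calc ∫⁻ x in Ω, ‖ψ x * w x‖ₑ ≤ ∫⁻ x, ‖ψ x * w x‖ₑ := setLIntegral_le_lintegral _ _
    _ = ∫⁻ x in K, ‖ψ x * w x‖ₑ := by
        rw [← lintegral_indicator hKm]
        refine lintegral_congr fun x => ?_
        by_cases hx : x ∈ K
        · rw [indicator_of_mem hx]
        · rw [indicator_of_notMem hx, image_eq_zero_of_notMem_tsupport hx, zero_mul, enorm_zero]
    _ ≤ ∫⁻ x in K, ENNReal.ofReal M * ‖w x‖ₑ := by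
        refine lintegral_mono fun x => ?_
        rw [enorm_mul, ← ofReal_norm (ψ x)]
        gcongr
        exact hM x
    _ = ENNReal.ofReal M * ∫⁻ x in K, ‖w x‖ₑ := lintegral_const_mul' _ _ (by simp)
    _ ≤ ENNReal.ofReal M * (C * lorentzNorm (volume.restrict K) p q w) := by
        gcongr
        exact hCle w (hw.mono_measure hle).norm
    _ ≤ ENNReal.ofReal M * (C * lorentzNorm (volume.restrict Ω) p q w) := by
        gcongr
        exact lorentzNorm_mono hq (distribution_mono_measure hle w)
    _ = _ := by rw [mul_assoc]

/-- Pairing with a fixed compactly supported continuous function is continuous for the Lorentz norm,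
since that norm controls L¹ on compact sets. -/
theorem tendsto_setIntegral_mul (hp : 0 < p) (hq : 1 ≤ q) {ψ : EuclideanSpace ℝ (Fin n) → ℝ}
    (hψ : Continuous ψ) (hψc : HasCompactSupport ψ) (hψΩ : tsupport ψ ⊆ Ω)
    {w : EuclideanSpace ℝ (Fin n) → ℝ} {wk : ℕ → EuclideanSpace ℝ (Fin n) → ℝ}
    (hw : MemLorentz (volume.restrict Ω) p q w)
    (hwk : ∀ k, AEMeasurable (wk k) (volume.restrict Ω))
    (hlim : Tendsto (fun k => lorentzNorm (volume.restrict Ω) p q (w - wk k)) atTop (𝓝 0)) :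
    Tendsto (fun k => ∫ x in Ω, ψ x * wk k x) atTop (𝓝 (∫ x in Ω, ψ x * w x)) := by
  obtain ⟨C, hC, hCle⟩ := exists_lintegral_mul_le (p := p) (q := q) hp hq hψ hψc hψΩ
  have hbound : ∀ k, ∫⁻ x in Ω, ‖ψ x * wk k x - ψ x * w x‖ₑ ≤
      C * lorentzNorm (volume.restrict Ω) p q (w - wk k) := fun k => by
    refine le_trans (le_of_eq (lintegral_congr fun x => ?_)) (hCle _ (hw.1.sub (hwk k)))
    rw [Pi.sub_apply, mul_sub, enorm_sub_rev]
  have hz : Tendsto (fun k => C * lorentzNorm (volume.restrict Ω) p q (w - wk k)) atTop (𝓝 0) := by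
    simpa using ENNReal.Tendsto.const_mul hlim (Or.inr hC)
  have hwm : AEStronglyMeasurable (fun x => ψ x * w x) (volume.restrict Ω) :=
    (hψ.measurable.aemeasurable.mul hw.1).aestronglyMeasurable
  have hwkm : ∀ k, AEStronglyMeasurable (fun x => ψ x * wk k x) (volume.restrict Ω) := fun k =>
    (hψ.measurable.aemeasurable.mul (hwk k)).aestronglyMeasurable
  have hint : Integrable (fun x => ψ x * w x) (volume.restrict Ω) :=
    ⟨hwm, (hCle w hw.1).trans_lt (ENNReal.mul_lt_top hC.lt_top hw.2)⟩
  refine tendsto_integral_of_L1 _ hwm ?_ (tendsto_of_tendsto_of_tendsto_of_le_of_le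
    tendsto_const_nhds hz (fun _ => zero_le) hbound)
  filter_upwards [hz.eventually_lt_const (u := ⊤) (by simp)] with k hk
  have hd : Integrable (fun x => ψ x * wk k x - ψ x * w x) (volume.restrict Ω) :=
    ⟨(hwkm k).sub hwm, (hbound k).trans_lt hk⟩
  exact (hd.add hint).congr (Eventually.of_forall fun x => sub_add_cancel _ _)

theorem setIntegral_mul_fderiv_eq (hΩ : IsOpen Ω) {ψ φ : EuclideanSpace ℝ (Fin n) → ℝ}
    (hψ : ψ ∈ testFunctions Ω) (hφ : ContDiffOn ℝ ∞ φ Ω) (e : EuclideanSpace ℝ (Fin n)) :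
    ∫ x in Ω, ψ x * fderiv ℝ φ x e = -∫ x in Ω, fderiv ℝ ψ x e * φ x := by
  obtain ⟨hψ1, hψ2, hψ3⟩ := hψ
  have hsub : (tsupport fun x => fderiv ℝ ψ x e) ⊆ tsupport ψ := tsupport_fderiv_apply_subset ℝ e
  have hdψ : Continuous fun x => fderiv ℝ ψ x e := (hψ1.continuous_fderiv (by simp)).clm_apply
    continuous_const
  have hdφ : ContinuousOn (fun x => fderiv ℝ φ x e) Ω :=
    (hφ.continuousOn_fderiv_of_isOpen hΩ (by simp)).clm_apply continuousOn_const
  -- φ is regular only on Ω; multiplied by a factor with compact support in Ω it becomes continuous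
  -- on the whole space, hence integrable.
  have hI : ∀ {a b : EuclideanSpace ℝ (Fin n) → ℝ}, Continuous a → HasCompactSupport a →
      tsupport a ⊆ Ω → ContinuousOn b Ω → Integrable (fun x => a x * b x) := by
    intro a b ha hac haΩ hb
    have hs : tsupport (fun x => a x * b x) ⊆ tsupport a := tsupport_mul_subset_left
    exact ((ha.continuousOn.mul hb).continuous_of_tsupport_subset hΩ
      (hs.trans haΩ)).integrable_of_hasCompactSupport hac.mul_right
  rw [setIntegral_eq_integral_of_forall_compl_eq_zero, setIntegral_eq_integral_of_forall_compl_eq_zero]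
  · refine integral_mul_fderiv_eq_neg_fderiv_mul_of_integrable
      (hI hdψ (hψ2.fderiv_apply ℝ e) (hsub.trans hψ3) hφ.continuousOn)
      (hI hψ1.continuous hψ2 hψ3 hdφ) (hI hψ1.continuous hψ2 hψ3 hφ.continuousOn)
      (fun x _ => (hψ1.differentiable (by simp)) x) fun x hx => ?_
    exact (hφ.differentiableOn (by simp)).differentiableAt (hΩ.mem_nhds (hψ3 hx))
  · intro x hx
    rw [image_eq_zero_of_notMem_tsupport (f := fun x => fderiv ℝ ψ x e)
      fun h => hx (hψ3 (hsub h)), zero_mul]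
  · intro x hx
    rw [image_eq_zero_of_notMem_tsupport fun h => hx (hψ3 h), zero_mul]

theorem MemLorentz.apply {μ : Measure (EuclideanSpace ℝ (Fin n))} (hq : 1 ≤ q)
    {V : EuclideanSpace ℝ (Fin n) → EuclideanSpace ℝ (Fin n)} (hV : MemLorentz μ p q V)
    (i : Fin n) : MemLorentz μ p q (fun x => V x i) := by
  refine ⟨(EuclideanSpace.proj (𝕜 := ℝ) i).continuous.measurable.comp_aemeasurable hV.1,
    (lorentzNorm_mono hq (distribution_mono_ae (Eventually.of_forall fun x => ?_))).trans_lt hV.2⟩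
  exact enorm_le_iff_norm_le.2 (PiLp.norm_apply_le _ _)

/-- Both sides of the classical integration by parts for φ_k converge. -/
theorem isWeakPartial_of_tendsto (hΩ : IsOpen Ω) (hp : 0 < p) (hq : 1 ≤ q)
    {u : EuclideanSpace ℝ (Fin n) → ℝ}
    {V : EuclideanSpace ℝ (Fin n) → EuclideanSpace ℝ (Fin n)}
    (hu : MemLorentz (volume.restrict Ω) p q u) (hV : MemLorentz (volume.restrict Ω) p q V)
    {φ : ℕ → EuclideanSpace ℝ (Fin n) → ℝ} (hφ : ∀ k, ContDiffOn ℝ ∞ (φ k) Ω)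
    (hu' : Tendsto (fun k => lorentzNorm (volume.restrict Ω) p q (u - φ k)) atTop (𝓝 0))
    (hV' : Tendsto (fun k => lorentzNorm (volume.restrict Ω) p q (V - gradient (φ k)))
      atTop (𝓝 0)) (i : Fin n) : IsWeakPartial Ω i u (fun x => V x i) := by
  refine ⟨hu.locallyIntegrableOn hΩ hp hq, (hV.apply hq i).locallyIntegrableOn hΩ hp hq,
    fun ψ hψ => ?_⟩
  have hsub : (tsupport fun x => fderiv ℝ ψ x (EuclideanSpace.single i 1)) ⊆ tsupport ψ :=
    tsupport_fderiv_apply_subset ℝ _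
  have hgm : ∀ k, AEMeasurable (gradient (φ k)) (volume.restrict Ω) := fun k =>
    (continuousOn_gradient hΩ (hφ k)).aemeasurable hΩ.measurableSet
  have h1 := tendsto_setIntegral_mul hp hq hψ.1.continuous hψ.2.1 hψ.2.2 (hV.apply hq i)
    (wk := fun k x => gradient (φ k) x i)
    (fun k => (EuclideanSpace.proj (𝕜 := ℝ) i).continuous.measurable.comp_aemeasurable (hgm k))
    (tendsto_of_tendsto_of_tendsto_of_le_of_le tendsto_const_nhds hV' (fun _ => zero_le)
      fun k => lorentzNorm_mono hq (distribution_mono_ae (Eventually.of_forall fun x =>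
        enorm_le_iff_norm_le.2 (PiLp.norm_apply_le ((V - gradient (φ k)) x) i))))
  have h2 := tendsto_setIntegral_mul hp hq
    ((hψ.1.continuous_fderiv (by simp)).clm_apply continuous_const)
    (hψ.2.1.fderiv_apply ℝ (EuclideanSpace.single i 1)) (hsub.trans hψ.2.2) hu
    (fun k => (hφ k).continuousOn.aemeasurable hΩ.measurableSet) hu'
  refine tendsto_nhds_unique h1 (h2.neg.congr fun k => ?_)
  simp only [gradient_apply]
  exact (setIntegral_mul_fderiv_eq hΩ hψ (hφ k) _).symm

theorem integrable_mul_of_locallyIntegrableOn {ψ w : EuclideanSpace ℝ (Fin n) → ℝ}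
    (hψ : Continuous ψ) (hψc : HasCompactSupport ψ) (hψΩ : tsupport ψ ⊆ Ω)
    (hw : LocallyIntegrableOn w Ω) : Integrable (fun x => ψ x * w x) := by
  refine (integrableOn_iff_integrable_of_support_subset (s := tsupport ψ) fun x hx => ?_).1
    ((hw.integrableOn_compact_subset hψΩ hψc).continuousOn_mul hψ.continuousOn hψc)
  exact subset_tsupport _ (left_ne_zero_of_mul hx)

/-- The difference annihilates all test functions, so the fundamental lemma of the calculus of
variations applies. -/
theorem IsWeakPartial.ae_eq (hΩ : IsOpen Ω) {i : Fin n}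
    {u w w' : EuclideanSpace ℝ (Fin n) → ℝ} (hw : IsWeakPartial Ω i u w)
    (hw' : IsWeakPartial Ω i u w') : ∀ᵐ x, x ∈ Ω → w x = w' x := by
  have h := hΩ.ae_eq_zero_of_integral_contDiff_smul_eq_zero (f := w - w')
    (hw.2.1.sub hw'.2.1) fun g hg hgc hgΩ => ?_
  · filter_upwards [h] with x hx hxΩ
    exact sub_eq_zero.1 (hx hxΩ)
  · have e1 := integrable_mul_of_locallyIntegrableOn hg.continuous hgc hgΩ hw.2.1
    have e2 := integrable_mul_of_locallyIntegrableOn hg.continuous hgc hgΩ hw'.2.1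
    have h0 : ∀ w : EuclideanSpace ℝ (Fin n) → ℝ, ∫ x in Ω, g x * w x = ∫ x, g x * w x :=
      fun w => setIntegral_eq_integral_of_forall_compl_eq_zero fun x hx => by
        rw [image_eq_zero_of_notMem_tsupport fun h => hx (hgΩ h), zero_mul]
    simp only [Pi.sub_apply, smul_eq_mul, mul_sub]
    rw [integral_sub e1 e2, ← h0, ← h0, hw.2.2 g ⟨hg, hgc, hgΩ⟩, hw'.2.2 g ⟨hg, hgc, hgΩ⟩, sub_self]

theorem IsWeakPartial.mono {Ω' : Set (EuclideanSpace ℝ (Fin n))} (hΩ : Ω' ⊆ Ω) {i : Fin n}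
    {u w : EuclideanSpace ℝ (Fin n) → ℝ} (hw : IsWeakPartial Ω i u w) :
    IsWeakPartial Ω' i u w := by
  refine ⟨hw.1.mono_set hΩ, hw.2.1.mono_set hΩ, fun φ hφ => ?_⟩
  have hsub : (tsupport fun x => fderiv ℝ φ x (EuclideanSpace.single i 1)) ⊆ tsupport φ :=
    tsupport_fderiv_apply_subset ℝ _
  have h0 : ∀ (S : Set (EuclideanSpace ℝ (Fin n))) (g w : EuclideanSpace ℝ (Fin n) → ℝ),
      tsupport g ⊆ S → ∫ x in S, g x * w x = ∫ x, g x * w x :=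
    fun S g w hg => setIntegral_eq_integral_of_forall_compl_eq_zero fun x hx => by
      rw [image_eq_zero_of_notMem_tsupport fun h => hx (hg h), zero_mul]
  have h := hw.2.2 φ ⟨hφ.1, hφ.2.1, hφ.2.2.trans hΩ⟩
  rw [h0 Ω _ _ (hφ.2.2.trans hΩ), h0 Ω _ _ ((hsub.trans hφ.2.2).trans hΩ)] at h
  rw [h0 Ω' _ _ hφ.2.2, h0 Ω' _ _ (hsub.trans hφ.2.2), h]

theorem toReal_min_pos (hp : 1 < p) (hq : 1 ≤ q) : 0 < (min (ENNReal.ofReal p) q).toReal := by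
  refine ENNReal.toReal_pos (ne_of_gt (lt_min ?_ (zero_lt_one.trans_le hq)))
    (ne_top_of_le_ne_top (by simp) (min_le_left _ _))
  simpa using zero_lt_one.trans hp

theorem lorentzNorm_le_pairNorm (hp : 1 < p) (hq : 1 ≤ q) (u : EuclideanSpace ℝ (Fin n) → ℝ)
    (V : EuclideanSpace ℝ (Fin n) → EuclideanSpace ℝ (Fin n)) :
    lorentzNorm (volume.restrict Ω) p q u ≤ pairNorm Ω p q u V ∧
      lorentzNorm (volume.restrict Ω) p q V ≤ pairNorm Ω p q u V := by
  have h := toReal_min_pos hp hq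
  constructor <;> unfold pairNorm <;> rw [one_div, ENNReal.le_rpow_inv_iff h]
  exacts [le_self_add, le_add_self]

theorem tendsto_pairNorm (hp : 1 < p) (hq : 1 ≤ q) {u : ℕ → EuclideanSpace ℝ (Fin n) → ℝ}
    {V : ℕ → EuclideanSpace ℝ (Fin n) → EuclideanSpace ℝ (Fin n)}
    (hu : Tendsto (fun k => lorentzNorm (volume.restrict Ω) p q (u k)) atTop (𝓝 0))
    (hV : Tendsto (fun k => lorentzNorm (volume.restrict Ω) p q (V k)) atTop (𝓝 0)) :
    Tendsto (fun k => pairNorm Ω p q (u k) (V k)) atTop (𝓝 0) := by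
  have h := toReal_min_pos hp hq
  have h1 := ((hu.ennrpow_const (min (ENNReal.ofReal p) q).toReal).add
    (hV.ennrpow_const (min (ENNReal.ofReal p) q).toReal)).ennrpow_const
    (1 / (min (ENNReal.ofReal p) q).toReal)
  rwa [ENNReal.zero_rpow_of_pos h, add_zero, ENNReal.zero_rpow_of_pos (by positivity)] at h1

theorem pairNorm_lt_top (hp : 1 < p) (hq : 1 ≤ q) {u : EuclideanSpace ℝ (Fin n) → ℝ}
    {V : EuclideanSpace ℝ (Fin n) → EuclideanSpace ℝ (Fin n)}
    (hu : lorentzNorm (volume.restrict Ω) p q u < ⊤)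
    (hV : lorentzNorm (volume.restrict Ω) p q V < ⊤) : pairNorm Ω p q u V < ⊤ := by
  have h := toReal_min_pos hp hq
  refine ENNReal.rpow_lt_top_of_nonneg (by positivity) (ne_of_lt (ENNReal.add_lt_top.2
    ⟨ENNReal.rpow_lt_top_of_nonneg h.le hu.ne, ENNReal.rpow_lt_top_of_nonneg h.le hV.ne⟩))

/-- Reduces non-membership in H to non-membership in W, where the candidate gradient is unique. -/
theorem H_subset_W (hΩ : IsOpen Ω) (hp : 1 < p) (hq : 1 ≤ q) : H Ω p q ⊆ W Ω p q := by
  rintro u ⟨hu, V, hV, φ, hφ, hlim⟩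
  refine ⟨hu, fun i => ⟨fun x => V x i, ?_, hV.apply hq i⟩⟩
  exact isWeakPartial_of_tendsto hΩ (by linarith) hq hu hV (fun k => (hφ k).1)
    (tendsto_of_tendsto_of_tendsto_of_le_of_le tendsto_const_nhds hlim (fun _ => zero_le)
      fun k => (lorentzNorm_le_pairNorm hp hq _ _).1)
    (tendsto_of_tendsto_of_tendsto_of_le_of_le tendsto_const_nhds hlim (fun _ => zero_le)
      fun k => (lorentzNorm_le_pairNorm hp hq _ _).2) i

theorem W_mono (hp : 1 < p) {q₁ q₂ : ℝ≥0∞} (hq₁ : 1 ≤ q₁) (hq : q₁ ≤ q₂) :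
    W Ω p q₁ ⊆ W Ω p q₂ := by
  have hm : ∀ w : EuclideanSpace ℝ (Fin n) → ℝ, MemLorentz (volume.restrict Ω) p q₁ w →
      MemLorentz (volume.restrict Ω) p q₂ w := fun w hw =>
    ⟨hw.1, (lorentzNorm_le_of_le (by linarith) hq₁ hq).trans_lt
      (ENNReal.mul_lt_top (by simp) hw.2)⟩
  rintro u ⟨hu, h⟩
  refine ⟨hm u hu, fun i => ?_⟩
  obtain ⟨w, hw1, hw2⟩ := h i
  exact ⟨w, hw1, hm w hw2⟩

theorem lorentzNorm_comp_sub {F : Type*} [NormedAddCommGroup F] (hq : 1 ≤ q)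
    (f : EuclideanSpace ℝ (Fin n) → F) (c : EuclideanSpace ℝ (Fin n)) :
    lorentzNorm volume p q (fun x => f (x - c)) = lorentzNorm volume p q f := by
  have h : ∀ s, distribution volume (fun x => f (x - c)) s = distribution volume f s := fun s => by
    rw [distribution, distribution,
      ← measure_preimage_add_right volume (-c) {x | s < ‖f x‖ₑ}]
    simp only [← sub_eq_add_neg]
    rfl
  exact le_antisymm (lorentzNorm_mono hq fun s => (h s).le)
    (lorentzNorm_mono hq fun s => (h s).ge)

theorem gradient_comp_sub (φ : EuclideanSpace ℝ (Fin n) → ℝ) (c : EuclideanSpace ℝ (Fin n)) :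
    gradient (fun x => φ (x - c)) = fun x => gradient φ (x - c) := by
  funext x
  rw [gradient, gradient, fderiv_comp_sub]

end WeakDerivatives

/-! ### Membership and non-membership of v, and strictness of the inclusion -/

section Main

variable {n : ℕ} {r α p : ℝ}

/-- Finite exponents `q' ≤ q` beyond the critical one. -/
theorem exists_finite_exponent (hα : 0 < α) (hα1 : α ≤ 1) {q : ℝ≥0∞}
    (hαq : ENNReal.ofReal (1 / α) < q) :
    ∃ q' : ℝ≥0∞, 1 ≤ q' ∧ q' ≠ ⊤ ∧ ENNReal.ofReal (1 / α) < q' ∧ q' ≤ q := by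
  have h1 : 1 ≤ ENNReal.ofReal (1 / α) := by
    rw [ENNReal.one_le_ofReal, le_div_iff₀ hα]; linarith
  obtain ⟨q', hq', hq'q⟩ := exists_between hαq
  exact ⟨q', h1.trans hq'.le, hq'q.ne_top, hq', hq'q.le⟩

theorem lorentzNorm_restrict_le {F : Type*} [NormedAddCommGroup F]
    (Ω : Set (EuclideanSpace ℝ (Fin n))) (hp : 0 < p) {q' q : ℝ≥0∞} (hq1 : 1 ≤ q') (hq : q' ≤ q)
    (f : EuclideanSpace ℝ (Fin n) → F) :
    lorentzNorm (volume.restrict Ω) p q f ≤ 4 * lorentzNorm volume p q' f :=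
  (lorentzNorm_mono (hq1.trans hq) (distribution_mono_measure Measure.restrict_le_self f)).trans
    (lorentzNorm_le_of_le hp hq1 hq)

theorem vReal_mem_sobolevClosure (hn : 1 ≤ n) (hr : 0 < r) (hp : 1 < p) (hα : 0 < α)
    (hα1 : α ≤ 1) {q : ℝ≥0∞} (hαq : ENNReal.ofReal (1 / α) < q)
    (Ω : Set (EuclideanSpace ℝ (Fin n))) {S : Set (EuclideanSpace ℝ (Fin n) → ℝ)}
    (hS : ∀ k, vApprox r α n p k ∈ S) : vReal r α n p ∈ sobolevClosure Ω p q S := by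
  -- Dominated convergence is applied with the finite q'; the embedding then gives convergence for
  -- q, possibly ∞.
  obtain ⟨q', hq1, hqt, hαq', hq⟩ := exists_finite_exponent hα hα1 hαq
  have hp0 : 0 < p := by linarith
  have hlim : ∀ {F : Type} [NormedAddCommGroup F] {D : ℕ → EuclideanSpace ℝ (Fin n) → F},
      Tendsto (fun k => lorentzNorm volume p q' (D k)) atTop (𝓝 0) →
      Tendsto (fun k => lorentzNorm (volume.restrict Ω) p q (D k)) atTop (𝓝 0) := by
    intro F _ D hD
    have h4 := ENNReal.Tendsto.const_mul (a := 4) hD (Or.inr (by simp))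
    rw [mul_zero] at h4
    exact tendsto_of_tendsto_of_tendsto_of_le_of_le tendsto_const_nhds h4 (fun _ => zero_le)
      fun k => lorentzNorm_restrict_le Ω hp0 hq1 hq (D k)
  refine ⟨⟨measurable_vReal.aemeasurable, ?_⟩, gradV r α n p,
    ⟨measurable_gradV.aemeasurable, ?_⟩, vApprox r α n p, hS, ?_⟩
  · exact (lorentzNorm_restrict_le Ω hp0 hq1 hq _).trans_lt
      (ENNReal.mul_lt_top (by simp) (lorentzNorm_vReal_lt_top hn hr hp hα hq1 hqt hαq'))
  · refine (lorentzNorm_restrict_le Ω hp0 hq1 hq _).trans_lt (ENNReal.mul_lt_top (by simp) ?_)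
    rw [lorentzNorm_gradV hr hp hα hq1]
    exact lorentzNorm_gradModulus_lt_top hn hr hp hα hqt hαq'
  · exact tendsto_pairNorm hp (hq1.trans hq)
      (hlim (tendsto_lorentzNorm_vReal_sub hn hr hp hα hq1 hqt hαq'))
      (hlim (tendsto_lorentzNorm_gradV_sub hn hr hp hα hq1 hqt hαq'))

theorem vApprox_mem_smoothFunctions (hn : 1 ≤ n) (hr : 0 < r) (hp : 1 < p) (hα : 0 < α)
    (hα1 : α ≤ 1) {q : ℝ≥0∞} (hαq : ENNReal.ofReal (1 / α) < q)
    (Ω : Set (EuclideanSpace ℝ (Fin n))) (k : ℕ) :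
    vApprox r α n p k ∈ smoothFunctions Ω p q := by
  have : NeZero n := ⟨by omega⟩
  have hne : ∀ᵐ x : EuclideanSpace ℝ (Fin n), x ≠ 0 := by simp [ae_iff]
  obtain ⟨q', hq1, hqt, hαq', hq⟩ := exists_finite_exponent hα hα1 hαq
  have hp0 : 0 < p := by linarith
  refine ⟨(contDiff_vApprox hr hp hα k).contDiffOn, pairNorm_lt_top hp (hq1.trans hq) ?_ ?_⟩
  · refine (lorentzNorm_restrict_le Ω hp0 hq1 hq _).trans_lt (ENNReal.mul_lt_top (by simp)
      ((lorentzNorm_mono hq1 (distribution_mono_ae ?_)).trans_lt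
        (lorentzNorm_vReal_lt_top hn hr hp hα hq1 hqt hαq')))
    filter_upwards [hne] with x hx
    have h1 := vApprox_nonneg (n := n) hr hp hα k x
    have h2 := vApprox_le hr hp hα k hx
    rw [Real.enorm_of_nonneg h1, Real.enorm_of_nonneg (h1.trans h2)]
    exact ENNReal.ofReal_le_ofReal h2
  · refine (lorentzNorm_restrict_le Ω hp0 hq1 hq _).trans_lt (ENNReal.mul_lt_top (by simp)
      ((lorentzNorm_mono hq1 (distribution_mono_ae ?_)).trans_lt
        (lorentzNorm_gradModulus_lt_top hn hr hp hα hqt hαq')))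
    filter_upwards [hne] with x hx
    have h0 : 0 < ‖x‖ := norm_pos_iff.2 hx
    have h1 := gCut_nonneg (n := n) hr hp hα k ‖x‖
    rw [enorm_gradModulus hr hp hα, ← ofReal_norm, gradient_vApprox hr hp hα k hx, norm_smul,
      norm_neg, norm_div, norm_norm, div_mul_cancel₀ _ h0.ne', Real.norm_of_nonneg h1]
    exact ENNReal.ofReal_le_ofReal (gCut_le hr hp hα k _)

/-- Stated on the whole space so that it restricts to balls, punctured balls and arbitrary Ω. The
exponent chosen in the proof is auxiliary: any finite q > 1/α makes the approximations converge. -/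
theorem isWeakPartial_vReal (hn : 1 ≤ n) (hr : 0 < r) (hp : 1 < p) (hα : 0 < α) (hα1 : α ≤ 1)
    (c : EuclideanSpace ℝ (Fin n)) (i : Fin n) :
    IsWeakPartial univ i (fun x => vReal r α n p (x - c)) (fun x => gradV r α n p (x - c) i) := by
  obtain ⟨q, hq1, hqt, hαq, -⟩ := exists_finite_exponent hα hα1
    (ENNReal.ofReal_lt_top (r := 1 / α))
  refine isWeakPartial_of_tendsto isOpen_univ (p := p) (q := q)
    (V := fun x => gradV r α n p (x - c)) (φ := fun k x => vApprox r α n p k (x - c))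
    (by linarith) hq1 ⟨?_, ?_⟩ ⟨?_, ?_⟩ (fun k => ?_) ?_ ?_ i
  · exact (measurable_vReal.comp (measurable_sub_const c)).aemeasurable
  · rw [Measure.restrict_univ, lorentzNorm_comp_sub hq1]
    exact lorentzNorm_vReal_lt_top hn hr hp hα hq1 hqt hαq
  · exact (measurable_gradV.comp (measurable_sub_const c)).aemeasurable
  · rw [Measure.restrict_univ, lorentzNorm_comp_sub hq1, lorentzNorm_gradV hr hp hα hq1]
    exact lorentzNorm_gradModulus_lt_top hn hr hp hα hqt hαq
  · exact ((contDiff_vApprox hr hp hα k).comp (contDiff_id.sub contDiff_const)).contDiffOn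
  · rw [Measure.restrict_univ]
    exact (tendsto_lorentzNorm_vReal_sub hn hr hp hα hq1 hqt hαq).congr fun k =>
      (lorentzNorm_comp_sub hq1 (vReal r α n p - vApprox r α n p k) c).symm
  · rw [Measure.restrict_univ]
    refine (tendsto_lorentzNorm_gradV_sub hn hr hp hα hq1 hqt hαq).congr fun k => ?_
    rw [gradient_comp_sub]
    exact (lorentzNorm_comp_sub hq1 (gradV r α n p - gradient (vApprox r α n p k)) c).symm

theorem enorm_le_sum_enorm (x : EuclideanSpace ℝ (Fin n)) : ‖x‖ₑ ≤ ∑ i, ‖x i‖ₑ := by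
  conv_lhs => rw [← (EuclideanSpace.basisFun (Fin n) ℝ).sum_repr x]
  refine (enorm_sum_le _ _).trans (le_of_eq (Finset.sum_congr rfl fun i _ => ?_))
  rw [enorm_smul, ← ofReal_norm ((EuclideanSpace.basisFun (Fin n) ℝ) i)]
  simp

/-- By uniqueness, weak derivatives in L^(p,q) would be the components of ∇v, whose norm is
infinite. Only the punctured ball has to lie in Ω, which lets the same statement serve both (i) and
(ii). -/
theorem vReal_notMem_W (hn : 1 ≤ n) (hr : 0 < r) (hp : 1 < p) (hα : 0 < α) (hα1 : α ≤ 1)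
    {q : ℝ≥0∞} (hq1 : 1 ≤ q) (hαq : q ≤ ENNReal.ofReal (1 / α))
    {Ω : Set (EuclideanSpace ℝ (Fin n))} (hΩ : IsOpen Ω) {c : EuclideanSpace ℝ (Fin n)}
    (hc : Metric.ball c r \ {c} ⊆ Ω) : (fun x => vReal r α n p (x - c)) ∉ W Ω p q := by
  have : NeZero n := ⟨by omega⟩
  rintro ⟨-, h⟩
  choose w hw hwL using h
  have heq : ∀ i, ∀ᵐ x, x ∈ Ω → w i x = gradV r α n p (x - c) i := fun i =>
    (hw i).ae_eq hΩ ((isWeakPartial_vReal hn hr hp hα hα1 c i).mono (subset_univ _))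
  have hlt : lorentzNorm (volume.restrict Ω) p q (fun x => gradV r α n p (x - c)) < ⊤ := by
    refine lorentzNorm_lt_top_of_enorm_le_sum (w := w) hq1
      (ne_top_of_le_ne_top (by simp) hαq) ?_ fun i => (hwL i).2
    rw [ae_restrict_iff' hΩ.measurableSet]
    filter_upwards [ae_all_iff.2 heq] with x hx hxΩ
    simp only [hx _ hxΩ]
    exact enorm_le_sum_enorm _
  -- Restricting to Ω loses nothing: the gradient vanishes off the ball and the centre is a null
  -- set.
  have hle : lorentzNorm volume p q (fun x => gradV r α n p (x - c)) ≤
      lorentzNorm (volume.restrict Ω) p q (fun x => gradV r α n p (x - c)) := by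
    refine lorentzNorm_mono hq1 fun s => ?_
    unfold distribution
    rw [Measure.restrict_apply' hΩ.measurableSet]
    have hne : ∀ᵐ x : EuclideanSpace ℝ (Fin n), x ≠ c := by simp [ae_iff]
    refine measure_mono_ae ?_
    filter_upwards [hne] with x hx (hs : s < _)
    refine ⟨hs, hc ⟨?_, hx⟩⟩
    rw [mem_ball_iff_norm]
    by_contra hcon
    rw [gradV_eq_zero (not_lt.1 hcon), enorm_zero] at hs
    exact not_lt_zero hs
  rw [lorentzNorm_comp_sub hq1, lorentzNorm_gradV hr hp hα hq1,
    lorentzNorm_gradModulus_eq_top hn hr hp hα hq1 hαq] at hle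
  exact absurd hlt (not_lt.2 hle)

theorem vReal_mem_W (hn : 1 ≤ n) (hr : 0 < r) (hp : 1 < p) (hα : 0 < α) (hα1 : α ≤ 1)
    {q : ℝ≥0∞} (hαq : ENNReal.ofReal (1 / α) < q) (Ω : Set (EuclideanSpace ℝ (Fin n)))
    (c : EuclideanSpace ℝ (Fin n)) : (fun x => vReal r α n p (x - c)) ∈ W Ω p q := by
  obtain ⟨q', hq1, hqt, hαq', hq⟩ := exists_finite_exponent hα hα1 hαq
  have hp0 : 0 < p := by linarith
  have hV : MemLorentz (volume.restrict Ω) p q (fun x => gradV r α n p (x - c)) := by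
    refine ⟨(measurable_gradV.comp (measurable_sub_const c)).aemeasurable,
      (lorentzNorm_restrict_le Ω hp0 hq1 hq _).trans_lt (ENNReal.mul_lt_top (by simp) ?_)⟩
    rw [lorentzNorm_comp_sub hq1, lorentzNorm_gradV hr hp hα hq1]
    exact lorentzNorm_gradModulus_lt_top hn hr hp hα hqt hαq'
  refine ⟨⟨(measurable_vReal.comp (measurable_sub_const c)).aemeasurable,
      (lorentzNorm_restrict_le Ω hp0 hq1 hq _).trans_lt (ENNReal.mul_lt_top (by simp) ?_)⟩,
    fun i => ⟨_, (isWeakPartial_vReal hn hr hp hα hα1 c i).mono (subset_univ _),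
      hV.apply (hq1.trans hq) i⟩⟩
  rw [lorentzNorm_comp_sub hq1]
  exact lorentzNorm_vReal_lt_top hn hr hp hα hq1 hqt hαq'

theorem W_ssubset (hn : 1 ≤ n) (hp : 1 < p) {q₁ q₂ : ℝ≥0∞} (hq₁ : 1 ≤ q₁) (hq : q₁ < q₂)
    {Ω : Set (EuclideanSpace ℝ (Fin n))} (hΩ : IsOpen Ω) (hne : Ω.Nonempty) :
    W Ω p q₁ ⊂ W Ω p q₂ := by
  have hq₁t : q₁ ≠ ⊤ := hq.ne_top
  have hQ : 1 ≤ q₁.toReal := by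
    simpa using (ENNReal.toReal_le_toReal ENNReal.one_ne_top hq₁t).2 hq₁
  -- The choice α = 1/q₁ makes q₁ the critical exponent, which is still excluded, while every q₂ >
  -- q₁ is admitted.
  have hα : 0 < 1 / q₁.toReal := by positivity
  have hα1 : 1 / q₁.toReal ≤ 1 := by rw [div_le_one (by linarith)]; exact hQ
  have hαq : ENNReal.ofReal (1 / (1 / q₁.toReal)) = q₁ := by
    rw [one_div_one_div, ENNReal.ofReal_toReal hq₁t]
  obtain ⟨c, hc⟩ := hne
  obtain ⟨r, hr, hrΩ⟩ := Metric.isOpen_iff.1 hΩ c hc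
  rw [ssubset_iff_of_subset (W_mono hp hq₁ hq.le)]
  exact ⟨_, vReal_mem_W hn hr hp hα hα1 (hαq.trans_lt hq) Ω c,
    vReal_notMem_W hn hr hp hα hα1 hq₁ hαq.ge hΩ (sdiff_subset.trans hrΩ)⟩

theorem vReal_notMem_H (hn : 1 ≤ n) (hr : 0 < r) (hp : 1 < p) (hα : 0 < α) (hα1 : α ≤ 1)
    {q : ℝ≥0∞} (hq1 : 1 ≤ q) (hαq : q ≤ ENNReal.ofReal (1 / α))
    {Ω : Set (EuclideanSpace ℝ (Fin n))} (hΩ : IsOpen Ω) (hc : Metric.ball 0 r \ {0} ⊆ Ω) :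
    vReal r α n p ∉ H Ω p q := fun h => by
  have h1 := vReal_notMem_W hn hr hp hα hα1 hq1 hαq hΩ hc
  simp only [sub_zero] at h1
  exact h1 (H_subset_W hΩ hp hq1 h)

end Main

end SobolevLorentz

end

theorem mainTheorem2 (n : ℕ) (hn : 1 ≤ n) (p : ℝ) (hp : 1 < p)
    (q₁ q₂ : ℝ≥0∞) (hq₁ : 1 ≤ q₁) (hq : q₁ < q₂) :
    (∀ r α : ℝ, 0 < r → 0 < α → α ≤ 1 →
      q₁ ≤ ENNReal.ofReal (1 / α) → ENNReal.ofReal (1 / α) < q₂ →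
      (SobolevLorentz.vReal r α n p ∈
          SobolevLorentz.H₀ (Metric.ball (0 : EuclideanSpace ℝ (Fin n)) r) p q₂ ∧
        SobolevLorentz.vReal r α n p ∉
          SobolevLorentz.H (Metric.ball (0 : EuclideanSpace ℝ (Fin n)) r) p q₁) ∧
      (SobolevLorentz.vReal r α n p ∈
          SobolevLorentz.H (Metric.ball (0 : EuclideanSpace ℝ (Fin n)) r \ {0}) p q₂ ∧
        SobolevLorentz.vReal r α n p ∉
          SobolevLorentz.H (Metric.ball (0 : EuclideanSpace ℝ (Fin n)) r \ {0}) p q₁)) ∧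
    (∀ Ω : Set (EuclideanSpace ℝ (Fin n)), IsOpen Ω → Ω.Nonempty →
      SobolevLorentz.W Ω p q₁ ⊂ SobolevLorentz.W Ω p q₂) := by
  refine ⟨fun r α hr hα hα1 h1 h2 => ?_,
    fun Ω hΩ hne => SobolevLorentz.W_ssubset hn hp hq₁ hq hΩ hne⟩
  -- The approximants are smooth on the whole space, so one sequence serves the ball, the punctured
  -- ball and, being test functions of the ball, also `H₀`.
  have hH : ∀ Ω, SobolevLorentz.vReal r α n p ∈ SobolevLorentz.H Ω p q₂ := fun Ω =>
    SobolevLorentz.vReal_mem_sobolevClosure hn hr hp hα hα1 h2 Ω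
      (SobolevLorentz.vApprox_mem_smoothFunctions hn hr hp hα hα1 h2 Ω)
  exact ⟨⟨⟨hH _, SobolevLorentz.vReal_mem_sobolevClosure hn hr hp hα hα1 h2 _
        (SobolevLorentz.vApprox_mem_testFunctions hr hp hα)⟩,
      SobolevLorentz.vReal_notMem_H hn hr hp hα hα1 hq₁ h1 Metric.isOpen_ball sdiff_subset⟩,
    hH _, SobolevLorentz.vReal_notMem_H hn hr hp hα hα1 hq₁ h1
      (Metric.isOpen_ball.sdiff isClosed_singleton) Subset.rfl⟩
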